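/- Let $p$ be a prime, let $G$ be a profinite group and let $\theta\colon G\to\mathbb Z_p^\times$ be a continuous homomorphism. All $G$-modules are discrete and $H^i$ denotes continuous cochain cohomology. For $n\ge 1$ let $\mathbb Z/p^n\mathbb Z(1)$ be $\mathbb Z_p/p^n\mathbb Z_p$ with $g\in G$ acting as multiplication by $\theta(g)$, and let $S=\mathbb Q_p/\mathbb Z_p\ (\simeq\mathbb Q/\mathbb Z_{(p)})$ with $g\in G$ acting as multiplication by $\theta(g)$. A *Hilbert 90 module* for $(G,\theta)$ is a discrete $G$-module $M$ such that (i) $pM=M$, (ii) the $p$-primary torsion subgroup $M\{p\}$ is isomorphic to $S$ as a $G$-module, and (iii) $H^1(H,M)=0$ for every open subgroup $H\subset G$. The pair $(G,\theta)$ *satisfies formal Hilbert 90* if for every open subgroup $H\subset G$ and every $n\ge 1$ the reduction map $H^1(H,\mathbb Z/p^n\mathbb Z(1))\to H^1(H,\mathbb Z/p\mathbb Z(1))$ is surjective. Suppose that $(G,\theta)$ admits a Hilbert 90 module, or that $(G,\theta)$ satisfies formal Hilbert 90. Let $\chi\colon G\to\mathbb Z/p\mathbb Z$ be a continuous character and let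 $H=\operatorname{Ker}(\chi)$. Then the sequence $$H^1(H,\mathbb Z/p\mathbb Z)\xrightarrow{\ \mathrm{Cor}\ }H^1(G,\mathbb Z/p\mathbb Z)\xrightarrow{\ \cup\chi\ }H^2(G,\mathbb Z/p\mathbb Z)\xrightarrow{\ \mathrm{Res}\ }H^2(H,\mathbb Z/p\mathbb Z),$$ with trivial action on $\mathbb Z/p\mathbb Z$, is exact (that is, exact at $H^1(G,\mathbb Z/p\mathbb Z)$ and at $H^2(G,\mathbb Z/p\mathbb Z)$). -/

import Mathlib

/-!
# Continuous cochain cohomology of profinite groups in degrees 1 and 2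

A `G`-module is given by an abelian group `A` together with `ρ : Representation ℤ G A`
(a homomorphism from `G` to the additive endomorphisms of `A`).  Coefficients always carry
the discrete topology, so a cochain is continuous if and only if it is locally constant.
Cochains are non-homogeneous.
-/

universe u v w

namespace ProfCoh

section Modules

variable {G : Type u} [Group G] {A : Type v} [AddCommGroup A]

/-- Restriction of a `G`-module to a subgroup `H`. -/
abbrev resRep (ρ : Representation ℤ G A) (H : Subgroup G) : Representation ℤ H A :=
  ρ.comp H.subtype

/-- `A` with the discrete topology is a discrete `G`-module: every stabilizer is open
(equivalently, the action map `G × A → A` is continuous). -/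
def IsDiscreteModule [TopologicalSpace G] (ρ : Representation ℤ G A) : Prop :=
  ∀ a : A, IsOpen {g : G | ρ g a = a}

end Modules

section Cohomology

variable {G : Type u} [Group G] [TopologicalSpace G] {A : Type v} [AddCommGroup A]

/-- Continuous 1-cocycles: `f (gh) = f g + g • f h`. -/
def Z1 (ρ : Representation ℤ G A) : AddSubgroup (G → A) where
  carrier := {f | IsLocallyConstant f ∧ ∀ g h, f (g * h) = f g + ρ g (f h)}
  zero_mem' := ⟨IsLocallyConstant.const 0, fun g h => by simp⟩
  add_mem' := by
    rintro a b ⟨ha, ha'⟩ ⟨hb, hb'⟩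
    refine ⟨ha.add hb, fun g h => ?_⟩
    simp only [Pi.add_apply, ha', hb', map_add]
    abel
  neg_mem' := by
    rintro a ⟨ha, ha'⟩
    refine ⟨ha.neg, fun g h => ?_⟩
    simp only [Pi.neg_apply, ha', map_neg]
    abel

/-- The coboundary of a 0-cochain: `a ↦ (g ↦ g • a - a)`. -/
def d0 (ρ : Representation ℤ G A) : A →+ (G → A) where
  toFun a g := ρ g a - a
  map_zero' := by ext; simp
  map_add' a b := by ext g; simp only [map_add, Pi.add_apply]; abel

/-- 1-coboundaries. -/
def B1 (ρ : Representation ℤ G A) : AddSubgroup (G → A) := (d0 ρ).range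

/-- `H¹(G, A)`. -/
abbrev H1 (ρ : Representation ℤ G A) : Type (max u v) :=
  Z1 ρ ⧸ (B1 ρ).addSubgroupOf (Z1 ρ)

/-- The class in `H¹(G, A)` of a continuous 1-cocycle. -/
def H1.mk (ρ : Representation ℤ G A) : Z1 ρ →+ H1 ρ := QuotientAddGroup.mk' _

/-- Continuous 2-cocycles: `g • f (h, k) - f (gh, k) + f (g, hk) - f (g, h) = 0`. -/
def Z2 (ρ : Representation ℤ G A) : AddSubgroup (G × G → A) where
  carrier := {f | IsLocallyConstant f ∧
    ∀ g h k, ρ g (f (h, k)) - f (g * h, k) + f (g, h * k) - f (g, h) = 0}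
  zero_mem' := ⟨IsLocallyConstant.const 0, fun g h k => by simp⟩
  add_mem' := by
    rintro a b ⟨ha, ha'⟩ ⟨hb, hb'⟩
    refine ⟨ha.add hb, fun g h k => ?_⟩
    have := congrArg₂ (· + ·) (ha' g h k) (hb' g h k)
    simp only [Pi.add_apply, map_add, add_zero] at this ⊢
    rw [← this]; abel
  neg_mem' := by
    rintro a ⟨ha, ha'⟩
    refine ⟨ha.neg, fun g h k => ?_⟩
    have := congrArg (fun x => -x) (ha' g h k)
    simp only [Pi.neg_apply, map_neg, neg_zero] at this ⊢
    rw [← this]; abel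

/-- The coboundary of a 1-cochain: `(df)(g, h) = g • f h - f (gh) + f g`. -/
def d1 (ρ : Representation ℤ G A) : (G → A) →+ (G × G → A) where
  toFun f x := ρ x.1 (f x.2) - f (x.1 * x.2) + f x.1
  map_zero' := by ext; simp
  map_add' a b := by ext x; simp only [map_add, Pi.add_apply]; abel

/-- 2-coboundaries, that is, coboundaries of continuous 1-cochains. -/
def B2 (ρ : Representation ℤ G A) : AddSubgroup (G × G → A) where
  carrier := {c | ∃ f : G → A, IsLocallyConstant f ∧ d1 ρ f = c}
  zero_mem' := ⟨0, IsLocallyConstant.const 0, map_zero _⟩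
  add_mem' := by
    rintro _ _ ⟨a, ha, rfl⟩ ⟨b, hb, rfl⟩
    exact ⟨a + b, ha.add hb, map_add _ _ _⟩
  neg_mem' := by
    rintro _ ⟨a, ha, rfl⟩
    exact ⟨-a, ha.neg, map_neg _ _⟩

/-- `H²(G, A)`. -/
abbrev H2 (ρ : Representation ℤ G A) : Type (max u v) :=
  Z2 ρ ⧸ (B2 ρ).addSubgroupOf (Z2 ρ)

/-- The class in `H²(G, A)` of a continuous 2-cocycle. -/
def H2.mk (ρ : Representation ℤ G A) : Z2 ρ →+ H2 ρ := QuotientAddGroup.mk' _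

end Cohomology

section Functoriality

variable {G : Type u} [Group G] [TopologicalSpace G]
  {A : Type v} [AddCommGroup A] {B : Type w} [AddCommGroup B]

/-- The map on 1-cocycles induced by a `G`-module homomorphism. -/
def Z1.map {ρ : Representation ℤ G A} {σ : Representation ℤ G B}
    (f : Representation.IntertwiningMap ρ σ) : Z1 ρ →+ Z1 σ where
  toFun c := ⟨fun g => f (c.1 g), c.2.1.comp f, fun g h => by
    change f (c.1 (g * h)) = f (c.1 g) + σ g (f (c.1 h))
    rw [c.2.2, map_add, f.isIntertwining]⟩
  map_zero' := by ext; simp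
  map_add' a b := by ext; simp

/-- The map `H¹(G, A) → H¹(G, B)` induced by a `G`-module homomorphism `A → B`. -/
def H1.map {ρ : Representation ℤ G A} {σ : Representation ℤ G B}
    (f : Representation.IntertwiningMap ρ σ) : H1 ρ →+ H1 σ :=
  QuotientAddGroup.map _ _ (Z1.map f) (by
    rintro c ⟨a, ha⟩
    refine ⟨f a, ?_⟩
    ext g
    have := congrFun ha g
    change ρ g a - a = c.1 g at this
    change σ g (f a) - f a = f (c.1 g)
    rw [← this, map_sub, f.isIntertwining])

end Functoriality

section Restriction

variable {G : Type u} [Group G] [TopologicalSpace G] {A : Type v} [AddCommGroup A]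

/-- Restriction of 2-cocycles to a subgroup. -/
def Z2.res (ρ : Representation ℤ G A) (H : Subgroup G) : Z2 ρ →+ Z2 (resRep ρ H) where
  toFun c := ⟨fun x => c.1 (x.1, x.2),
    c.2.1.comp_continuous (f := fun x : H × H => ((x.1 : G), (x.2 : G))) (by fun_prop),
    fun g h k => c.2.2 g h k⟩
  map_zero' := rfl
  map_add' _ _ := rfl

/-- The restriction map `Res : H²(G, A) → H²(H, A)`. -/
def H2.res (ρ : Representation ℤ G A) (H : Subgroup G) : H2 ρ →+ H2 (resRep ρ H) :=
  QuotientAddGroup.map _ _ (Z2.res ρ H) (by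
    rintro c ⟨f, hf, hc⟩
    refine ⟨fun h => f h, hf.comp_continuous continuous_subtype_val, ?_⟩
    ext x
    exact congrFun hc ((x.1 : G), (x.2 : G)))

end Restriction

section Transversal

variable {G : Type u} [Group G]

/-- With `t x` a chosen representative of a left coset `x` of `H`, the element
`(t (g • x))⁻¹ * g * t x` lies in `H`. -/
lemma transversal_mem (H : Subgroup G) (g : G) (x : G ⧸ H) :
    ((g • x).out)⁻¹ * g * x.out ∈ H := by
  rw [mul_assoc, ← QuotientGroup.eq, QuotientGroup.out_eq', ← smul_eq_mul,
    MulAction.Quotient.coe_smul_out]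

/-- The element `(t (g • x))⁻¹ * g * t x` of `H`. -/
noncomputable def transversalElt (H : Subgroup G) (g : G) (x : G ⧸ H) : H :=
  ⟨((g • x).out)⁻¹ * g * x.out, transversal_mem H g x⟩

lemma transversalElt_mul (H : Subgroup G) (g h : G) (x : G ⧸ H) :
    transversalElt H (g * h) x = transversalElt H g (h • x) * transversalElt H h x := by
  ext
  simp only [transversalElt, Subgroup.coe_mul, mul_smul]
  group

end Transversal

section Corestriction

variable {G : Type u} [Group G] [TopologicalSpace G] [IsTopologicalGroup G]

lemma isLocallyConstant_comp_transversalElt {H : Subgroup G} (hH : IsOpen (H : Set G))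
    {X : Type*} {f : H → X} (hf : IsLocallyConstant f) (x : G ⧸ H) :
    IsLocallyConstant fun g : G => (g • x, f (transversalElt H g x)) := by
  have h1 : IsLocallyConstant fun g : G => g • x := by
    have : DiscreteTopology (G ⧸ H) := QuotientGroup.discreteTopology hH
    rw [IsLocallyConstant.iff_continuous]
    exact continuous_id.smul continuous_const
  rw [IsLocallyConstant.iff_eventually_eq]
  intro g
  have hc : Continuous fun g' : G => ((g • x).out)⁻¹ * g' * x.out := by fun_prop
  have h2 : ∀ᶠ g' in nhds g, ∀ hm : ((g • x).out)⁻¹ * g' * x.out ∈ H,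
      f ⟨_, hm⟩ = f (transversalElt H g x) := by
    have ho : IsOpen (Subtype.val '' (f ⁻¹' {f (transversalElt H g x)})) :=
      hH.isOpenMap_subtype_val _ (hf _)
    have hn := (ho.preimage hc).mem_nhds (x := g) ⟨transversalElt H g x, rfl, rfl⟩
    filter_upwards [hn] with g' hg' hm
    obtain ⟨y, hy, hy'⟩ := hg'
    have : y = ⟨_, hm⟩ := Subtype.ext hy'
    rw [← this]; exact hy
  filter_upwards [h1.eventually_eq g, h2] with g' h1 h2
  have hm : ((g • x).out)⁻¹ * g' * x.out ∈ H := by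
    rw [← h1]; exact transversal_mem H g' x
  refine Prod.ext h1 ?_
  change f (transversalElt H g' x) = f (transversalElt H g x)
  rw [← h2 hm]
  congr 1
  ext
  simp only [transversalElt, h1]

variable [CompactSpace G] {A : Type v} [AddCommGroup A]

open Classical in
/-- The corestriction on non-homogeneous 1-cocycles for an open subgroup `H` of a profinite
group: with `t x` a representative of `x ∈ G/H`,
`(Cor f)(g) = ∑ x ∈ G/H, t (g x) • f ((t (g x))⁻¹ * g * t x)`. -/
noncomputable def Z1.cor (ρ : Representation ℤ G A) (H : Subgroup G) (hH : IsOpen (H : Set G)) :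
    Z1 (resRep ρ H) →+ Z1 ρ :=
  letI : Finite (G ⧸ H) := H.quotient_finite_of_isOpen hH
  letI : Fintype (G ⧸ H) := Fintype.ofFinite _
  { toFun := fun c => ⟨fun g => ∑ x : G ⧸ H, ρ (g • x).out (c.1 (transversalElt H g x)), by
      refine ⟨?_, fun g h => ?_⟩
      · have : ∀ s : Finset (G ⧸ H), IsLocallyConstant fun g : G =>
            ∑ x ∈ s, ρ (g • x).out (c.1 (transversalElt H g x)) := by
          intro s
          induction s using Finset.induction_on with
          | empty => exact IsLocallyConstant.of_constant _ fun _ _ => rfl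
          | insert a s ha ih =>
            simp only [Finset.sum_insert ha]
            exact IsLocallyConstant.add
              ((isLocallyConstant_comp_transversalElt hH c.2.1 a).comp
                fun q => ρ q.1.out q.2) ih
        exact this Finset.univ
      · have key : ∀ x : G ⧸ H, ρ ((g * h) • x).out (c.1 (transversalElt H (g * h) x)) =
            ρ (g • (h • x)).out (c.1 (transversalElt H g (h • x))) +
              ρ g (ρ (h • x).out (c.1 (transversalElt H h x))) := by
          intro x
          rw [transversalElt_mul, c.2.2, map_add, mul_smul]
          congr 1
          change (ρ _ * ρ (transversalElt H g (h • x) : G)) _ = (ρ g * ρ _) _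
          rw [← map_mul, ← map_mul]
          congr 2
          simp only [transversalElt]
          group
        simp only [key, Finset.sum_add_distrib, map_sum]
        congr 1
        exact Equiv.sum_comp (MulAction.toPerm h)
          fun x : G ⧸ H => ρ (g • x).out (c.1 (transversalElt H g x))⟩
    map_zero' := by ext g; simp
    map_add' := fun a b => by ext g; simp [Finset.sum_add_distrib] }

/-- The corestriction map `Cor : H¹(H, A) → H¹(G, A)` for an open subgroup `H`. -/
noncomputable def H1.cor (ρ : Representation ℤ G A) (H : Subgroup G) (hH : IsOpen (H : Set G)) :
    H1 (resRep ρ H) →+ H1 ρ :=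
  QuotientAddGroup.map _ _ (Z1.cor ρ H hH) (by
    classical
    let _ : Finite (G ⧸ H) := H.quotient_finite_of_isOpen hH
    let _ : Fintype (G ⧸ H) := Fintype.ofFinite _
    rintro c ⟨a, ha⟩
    refine ⟨∑ x : G ⧸ H, ρ x.out a, ?_⟩
    ext g
    change ρ g (∑ x : G ⧸ H, ρ x.out a) - ∑ x : G ⧸ H, ρ x.out a =
      ∑ x : G ⧸ H, ρ (g • x).out (c.1 (transversalElt H g x))
    have hc : ∀ h : H, c.1 h = ρ (h : G) a - a := fun h => (congrFun ha h).symm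
    have key : ∀ x : G ⧸ H, ρ (g • x).out (c.1 (transversalElt H g x)) =
        ρ g (ρ x.out a) - ρ (g • x).out a := by
      intro x
      rw [hc, map_sub]
      congr 1
      change (ρ _ * ρ (transversalElt H g x : G)) _ = (ρ g * ρ _) _
      rw [← map_mul, ← map_mul]
      congr 2
      simp only [transversalElt]
      group
    simp only [key, Finset.sum_sub_distrib, map_sum]
    congr 1
    exact (Equiv.sum_comp (MulAction.toPerm g) fun x : G ⧸ H => ρ x.out a).symm)

end Corestriction

section CupProduct

variable {G : Type u} [Group G] [TopologicalSpace G] (R : Type v) [CommRing R]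

/-- The cup product of 1-cocycles with values in a ring `R` on which `G` acts trivially:
`(a ∪ b)(g, h) = a g * b h`. -/
def Z1.cup : Z1 (Representation.trivial ℤ G R) →+
    Z1 (Representation.trivial ℤ G R) →+ Z2 (Representation.trivial ℤ G R) :=
  AddMonoidHom.mk' (fun a => AddMonoidHom.mk' (fun b => ⟨fun x => a.1 x.1 * b.1 x.2, by
      refine ⟨IsLocallyConstant.comp₂ (a.2.1.comp_continuous continuous_fst)
        (b.2.1.comp_continuous continuous_snd) (· * ·), fun g h k => ?_⟩
      have ha := a.2.2 g h
      have hb := b.2.2 h k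
      simp only [Representation.trivial_apply] at ha hb ⊢
      rw [ha, hb]
      ring⟩)
    (fun b b' => by ext x; simp [mul_add]))
    (fun a a' => by ext b x; simp [add_mul])

/-- With trivial action every 1-coboundary vanishes. -/
lemma eq_zero_of_mem_B1_trivial {A : Type*} [AddCommGroup A]
    {c : Z1 (Representation.trivial ℤ G A)}
    (hc : c ∈ (B1 (Representation.trivial ℤ G A)).addSubgroupOf (Z1 _)) : c = 0 := by
  obtain ⟨a, ha⟩ := hc
  ext g
  have := congrFun ha g
  change a - a = c.1 g at this
  simpa using this.symm

/-- The cup product `H¹(G, R) × H¹(G, R) → H²(G, R)` for trivial action on the ring `R`. -/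
def H1.cup : H1 (Representation.trivial ℤ G R) →+
    H1 (Representation.trivial ℤ G R) →+ H2 (Representation.trivial ℤ G R) :=
  QuotientAddGroup.lift _
    (AddMonoidHom.mk' (fun a => QuotientAddGroup.lift _ ((H2.mk _).comp (Z1.cup R a))
        (fun b hb => by
          rw [eq_zero_of_mem_B1_trivial hb]
          exact map_zero _))
      (fun a a' => by
        ext b
        simp))
    (fun a ha => by
      rw [eq_zero_of_mem_B1_trivial ha]
      exact map_zero _)

end CupProduct

/-- The `p`-primary torsion subgroup is stable under the action. -/
lemma apply_mem_primaryComponent {p : ℕ} {G : Type u} [Group G] {M : Type v} [AddCommGroup M]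
    (ρ : Representation ℤ G M) (g : G) {m : M} (hm : m ∈ AddCommGroup.primaryComponent M p) :
    ρ g m ∈ AddCommGroup.primaryComponent M p := by
  obtain ⟨k, hk⟩ := hm
  exact ⟨k, by rw [← map_nsmul, hk, map_zero]⟩

section Hilbert90

variable {p : ℕ} [Fact p.Prime] {G : Type u} [Group G] [TopologicalSpace G]

/-- The `G`-module with underlying group a `ℤ_p`-module `N`, where `g` acts as multiplication
by `θ g`. -/
noncomputable def twist (θ : G →* ℤ_[p]ˣ) (N : Type v) [AddCommGroup N] [Module ℤ_[p] N] :
    Representation ℤ G N where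
  toFun g := (DistribSMul.toAddMonoidHom N (θ g : ℤ_[p])).toIntLinearMap
  map_one' := by
    ext x
    change ((θ 1 : ℤ_[p]ˣ) : ℤ_[p]) • x = x
    rw [map_one, Units.val_one, one_smul]
  map_mul' g h := by
    ext x
    change ((θ (g * h) : ℤ_[p]ˣ) : ℤ_[p]) • x = (θ g : ℤ_[p]) • (θ h : ℤ_[p]) • x
    rw [map_mul, Units.val_mul, mul_smul]

/-- A `ℤ_p`-linear map, as a homomorphism of the corresponding `G`-modules. -/
noncomputable def twistMap (θ : G →* ℤ_[p]ˣ) {N : Type v} [AddCommGroup N] [Module ℤ_[p] N]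
    {N' : Type w} [AddCommGroup N'] [Module ℤ_[p] N'] (f : N →ₗ[ℤ_[p]] N') :
    Representation.IntertwiningMap (twist θ N) (twist θ N') where
  toLinearMap := f.toAddMonoidHom.toIntLinearMap
  isIntertwining' g := by
    ext x
    exact f.map_smul (θ g : ℤ_[p]) x

/-- The group `ℤ/pⁿ`, as the quotient `ℤ_p / pⁿ ℤ_p`.  With the action `twist θ _` it is
the `G`-module `ℤ/pⁿ(1)`. -/
abbrev ZMod1 (p : ℕ) [Fact p.Prime] (n : ℕ) : Type :=
  ℤ_[p] ⧸ Ideal.span {(p : ℤ_[p]) ^ n}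

/-- The reduction map `ℤ/pⁿ(1) → ℤ/p(1)` for `1 ≤ n`, induced by the identity of `ℤ_p`. -/
noncomputable def reduction (θ : G →* ℤ_[p]ˣ) (n : ℕ) (hn : 1 ≤ n) :
    Representation.IntertwiningMap (twist θ (ZMod1 p n)) (twist θ (ZMod1 p 1)) :=
  twistMap θ (Submodule.factor (Ideal.span_singleton_le_span_singleton.mpr
    (pow_dvd_pow (p : ℤ_[p]) hn)))

/-- `(G, θ)` satisfies formal Hilbert 90: for every open subgroup `H` of `G` and every `n ≥ 1`
the reduction map `H¹(H, ℤ/pⁿ(1)) → H¹(H, ℤ/p(1))` is surjective. -/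
def FormalHilbert90 (θ : G →ₜ* ℤ_[p]ˣ) : Prop :=
  ∀ H : Subgroup G, IsOpen (H : Set G) → ∀ (n : ℕ) (hn : 1 ≤ n),
    Function.Surjective (H1.map (reduction ((θ : G →* ℤ_[p]ˣ).comp H.subtype) n hn))

/-- The group `ℚ_p / ℤ_p`, which is canonically `ℚ / ℤ_(p)`.  With the action `twist θ _` it is
the colimit of the `G`-modules `ℤ/pⁿ(1)`. -/
abbrev QpModZp (p : ℕ) [Fact p.Prime] : Type :=
  ℚ_[p] ⧸ LinearMap.range (Algebra.linearMap ℤ_[p] ℚ_[p])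

/-- `M` is a Hilbert 90 module for `(G, θ)`. -/
structure IsHilbert90Module (θ : G →ₜ* ℤ_[p]ˣ) {M : Type v} [AddCommGroup M]
    (ρ : Representation ℤ G M) : Prop where
  /-- `M` is a discrete `G`-module. -/
  discrete : IsDiscreteModule ρ
  /-- `pM = M`. -/
  divisible : ∀ m : M, ∃ m' : M, p • m' = m
  /-- The `p`-primary torsion of `M` is isomorphic to `ℚ_p/ℤ_p` with the action through `θ`,
  as a `G`-module. -/
  torsion : ∃ e : AddCommGroup.primaryComponent M p ≃+ QpModZp p,
    ∀ (g : G) (m : AddCommGroup.primaryComponent M p),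
      e ⟨ρ g m, apply_mem_primaryComponent ρ g m.2⟩ = twist (θ : G →* ℤ_[p]ˣ) (QpModZp p) g (e m)
  /-- `H¹(H, M) = 0` for every open subgroup `H` of `G`. -/
  h1_eq_zero : ∀ H : Subgroup G, IsOpen (H : Set G) → Subsingleton (H1 (resRep ρ H))

/-- `(G, θ)` admits a Hilbert 90 module (in the universe `v`). -/
def AdmitsHilbert90Module (θ : G →ₜ* ℤ_[p]ˣ) : Prop :=
  ∃ (M : Type v) (_ : AddCommGroup M) (ρ : Representation ℤ G M), IsHilbert90Module θ ρ

end Hilbert90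

section Characters

variable {p : ℕ} {G : Type u} [Group G] [TopologicalSpace G]

/-- `ℤ/p` with the trivial `G`-action. -/
abbrev trivZMod (p : ℕ) (G : Type u) [Group G] : Representation ℤ G (ZMod p) :=
  Representation.trivial ℤ G (ZMod p)

/-- A (continuous) character `G → ℤ/p`, as a 1-cocycle. -/
def charZ1 (χ : G →ₜ* Multiplicative (ZMod p)) : Z1 (trivZMod p G) :=
  ⟨fun g => (χ g).toAdd,
    (IsLocallyConstant.iff_continuous _).2 (continuous_toAdd.comp χ.continuous_toFun),
    fun g h => by simp⟩

/-- The class in `H¹(G, ℤ/p)` of a character. -/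
def charClass (χ : G →ₜ* Multiplicative (ZMod p)) : H1 (trivZMod p G) :=
  H1.mk _ (charZ1 χ)

/-- The kernel of a character. -/
abbrev charKer (χ : G →ₜ* Multiplicative (ZMod p)) : Subgroup G :=
  (χ : G →* Multiplicative (ZMod p)).ker

/-- The kernel of a character is open. -/
lemma isOpen_charKer (χ : G →ₜ* Multiplicative (ZMod p)) : IsOpen (charKer χ : Set G) := by
  have : (charKer χ : Set G) = (fun g => (χ g).toAdd) ⁻¹' {0} := by
    ext g
    simp [MonoidHom.mem_ker]
  rw [this]
  exact (charZ1 χ).2.1 _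

/-- Corestriction `H¹(ker χ, ℤ/p) → H¹(G, ℤ/p)`. -/
noncomputable def corKer [IsTopologicalGroup G] [CompactSpace G]
    (χ : G →ₜ* Multiplicative (ZMod p)) :
    H1 (trivZMod p (charKer χ)) →+ H1 (trivZMod p G) :=
  H1.cor (trivZMod p G) (charKer χ) (isOpen_charKer χ)

/-- Cup product with the character: `H¹(G, ℤ/p) → H²(G, ℤ/p)`, `x ↦ x ∪ χ`. -/
def cupChar (χ : G →ₜ* Multiplicative (ZMod p)) :
    H1 (trivZMod p G) →+ H2 (trivZMod p G) :=
  AddMonoidHom.flip (H1.cup (G := G) (ZMod p)) (charClass χ)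

/-- Restriction `H²(G, ℤ/p) → H²(ker χ, ℤ/p)`. -/
def resKer (χ : G →ₜ* Multiplicative (ZMod p)) :
    H2 (trivZMod p G) →+ H2 (trivZMod p (charKer χ)) :=
  H2.res (trivZMod p G) (charKer χ)

end Characters

end ProfCoh

/-!
# The exact sequence of a character under formal Hilbert 90

Everything follows from lifting characters modulo `p²`.  After a change of the twist there is a
character `τ : G → (ℤ/p²)ˣ` with `τ ≡ 1` modulo `p` such that every character `K → ℤ/p` of every
open subgroup `K` lifts to a cocycle `K → ℤ/p²(τ)` (`LiftsCharacters`).  Under formal Hilbert 90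
this is immediate on the open subgroup where `θ ≡ 1` modulo `p`; a Hilbert 90 module gives it by
Kummer theory, dividing by `p` an element whose coboundary is the given character
(`IsHilbert90Module.liftsUntwisted`).  The index of that subgroup divides `p - 1`, so corestriction
extends the lifting property to all open subgroups, with `τ = θ ^ (p - 1)²` modulo `p²`
(`LiftsUntwisted.liftsCharacters`).

Now let `x : G → ℤ/p` be a nontrivial character with kernel `H`.  Cohomology of `H` is expressed
through the induced module of functions `φ : ℤ/p → R`, where `R = ℤ/p` or `ℤ/p²(τ)` and
`(g φ) i = τ g * φ (i + x g)`: corestriction is `φ ↦ ∑ i, φ i`, and by Shapiro's lemma cocycles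
in the induced module lift from `ℤ/p` to `ℤ/p²`, because characters of `H` do
(`exists_lift_induced`).

* If `b` trivializes `a ∪ x`, then `i ↦ i * a + b + x * a` is a cocycle in the induced module.
  Lift it to `u` and `a` to `a'`.  Then `u (i + 1) - u i - a' = p * c i` for a cocycle `c`, and
  summation over `i` gives `-a = ∑ i, c i`, a corestriction
  (`exists_sum_eq_of_cup_eq_coboundary`).
* If `z` is a 2-cocycle that is trivial on `H`, then `z` is the coboundary of a cochain `F` in the
  induced module.  The cocycle `F (i + 1) - F i` lifts to some `u`, whose sum over `i` is
  `p * a` for a character `a`.  Comparison with a set-theoretic lift of `F` shows that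
  `z - x ∪ a` is the Bockstein of the character `∑ i, F i` up to a coboundary, and Bocksteins
  vanish since characters of `G` lift (`exists_eq_cup_add_coboundary`).
* That the composite of corestriction and cup product is zero is seen on the first moment
  `∑ i, i * y i` of a cocycle `y` in the induced module (`cup_sum_eq_coboundary`).
-/

namespace ProfCoh

/-! ### Arithmetic modulo `p²` -/

section ModSq

variable (p : ℕ) [Fact p.Prime]

/-- Reduction `ℤ/p² → ℤ/p`. -/
abbrev redSq : ZMod (p ^ 2) →+* ZMod p :=
  ZMod.castHom (dvd_pow_self p two_ne_zero) (ZMod p)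

/-- A set-theoretic section of `redSq p`, sending `0` to `0`. -/
def liftSq (x : ZMod p) : ZMod (p ^ 2) := (x.val : ZMod (p ^ 2))

/-- Division by `p` of the multiples of `p` in `ℤ/p²`; the value is well defined only
modulo `p`, and is irrelevant on elements that are not multiples of `p`. -/
def divSq (x : ZMod (p ^ 2)) : ZMod (p ^ 2) := ((x.val / p : ℕ) : ZMod (p ^ 2))

variable {p}

@[simp] lemma redSq_liftSq (x : ZMod p) : redSq p (liftSq p x) = x := by
  simp [liftSq]

@[simp] lemma liftSq_zero : liftSq p 0 = 0 := by simp [liftSq]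

instance : NeZero (p ^ 2) := ⟨pow_ne_zero 2 (Fact.out : p.Prime).ne_zero⟩

lemma natCast_mul_eq_zero_iff (x : ZMod (p ^ 2)) :
    (p : ZMod (p ^ 2)) * x = 0 ↔ redSq p x = 0 := by
  obtain ⟨n, rfl⟩ := ZMod.natCast_zmod_surjective x
  rw [← Nat.cast_mul, ZMod.natCast_eq_zero_iff, map_natCast, ZMod.natCast_eq_zero_iff, pow_two]
  exact Nat.mul_dvd_mul_iff_left (Fact.out : p.Prime).pos

lemma natCast_mul_eq_iff (x y : ZMod (p ^ 2)) :
    (p : ZMod (p ^ 2)) * x = (p : ZMod (p ^ 2)) * y ↔ redSq p x = redSq p y := by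
  rw [← sub_eq_zero, ← mul_sub, natCast_mul_eq_zero_iff, map_sub, sub_eq_zero]

lemma natCast_mul_divSq {x : ZMod (p ^ 2)} (hx : redSq p x = 0) :
    (p : ZMod (p ^ 2)) * divSq p x = x := by
  have h : p ∣ x.val := by
    rwa [← ZMod.natCast_zmod_val x, map_natCast, ZMod.natCast_eq_zero_iff] at hx
  rw [divSq, ← Nat.cast_mul, Nat.mul_div_cancel' h, ZMod.natCast_zmod_val]

end ModSq

/-! ### Induced cocycles -/

section Induction

lemma IsLocallyConstant.fintype_sum {X ι A : Type*} [TopologicalSpace X] [Fintype ι]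
    [AddCommMonoid A] {F : X → ι → A} (hF : ∀ i, IsLocallyConstant fun x => F x i) :
    IsLocallyConstant fun x => ∑ i, F x i := by
  have : IsLocallyConstant F := by
    rw [IsLocallyConstant.iff_eventually_eq]
    intro x
    have := Filter.eventually_all.2 fun i => (hF i).eventually_eq x
    filter_upwards [this] with y hy
    exact funext hy
  exact this.comp fun φ => ∑ i, φ i

lemma map_inv_of_additive {G A : Type*} [Group G] [AddGroup A] {x : G → A}
    (hxm : ∀ g h, x (g * h) = x g + x h) (g : G) : x g⁻¹ = -x g := by
  have h1 : x 1 = 0 := by simpa using hxm 1 1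
  have := hxm g g⁻¹
  rw [mul_inv_cancel, h1] at this
  exact (neg_eq_of_add_eq_zero_right this.symm).symm

variable {p : ℕ} {G : Type u} [Group G] [TopologicalSpace G] [IsTopologicalGroup G]
  {R : Type*} [CommRing R]

/-- Let `x : G → ℤ/p` be an additive character with kernel `H` and let `s` be a section of `x`.
A cocycle on `H` with values in `R(τ)` extends to a function on `G` that satisfies the cocycle
relation for left translation by elements of `H`, with prescribed values at the `s i`. -/
lemma exists_extend_cocycle {x : G → ZMod p} (hx : IsLocallyConstant x)
    (hxm : ∀ g h, x (g * h) = x g + x h) {H : Subgroup G} (hH : ∀ g, g ∈ H ↔ x g = 0)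
    {s : ZMod p → G} (hs : ∀ i, x (s i) = i) (hs0 : s 0 = 1)
    {τ : G →* R} (hτ : IsLocallyConstant τ) {f : H → R} (hf : IsLocallyConstant f)
    (hfm : ∀ g h, f (g * h) = f g + τ g * f h) (r : ZMod p → R) (hr : r 0 = 0) :
    ∃ F : G → R, IsLocallyConstant F ∧ (∀ (h : H) (g : G), F (h * g) = F h + τ h * F g) ∧
      (∀ h : H, F h = f h) ∧ (∀ i, F (s i) = r i) := by
  have hmem (g : G) : g * (s (x g))⁻¹ ∈ H := by
    rw [hH, hxm, map_inv_of_additive hxm, hs, add_neg_cancel]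
  have hf1 : f 1 = 0 := by simpa using hfm 1 1
  have hcont : Continuous fun g : G => (⟨g * (s (x g))⁻¹, hmem g⟩ : H) :=
    (continuous_id.mul (hx.comp fun i => (s i)⁻¹).continuous).subtype_mk _
  have hval (h : H) : (f ⟨h * (s (x h))⁻¹, hmem h⟩ + τ (h * (s (x h))⁻¹) * r (x h)) = f h := by
    have h0 : x h = 0 := (hH _).1 h.2
    simp only [h0, hs0, hr, inv_one, mul_one, mul_zero, add_zero]
  refine ⟨fun g => f ⟨g * (s (x g))⁻¹, hmem g⟩ + τ (g * (s (x g))⁻¹) * r (x g), ?_, ?_, hval, ?_⟩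
  · refine (hf.comp_continuous hcont).add (IsLocallyConstant.mul ?_ (hx.comp r))
    exact hτ.comp_continuous (continuous_subtype_val.comp hcont)
  · intro h g
    beta_reduce
    rw [hval]
    have h0 : x (h * g) = x g := by rw [hxm, (hH _).1 h.2, zero_add]
    have e : (⟨h * g * (s (x (h * g)))⁻¹, hmem (h * g)⟩ : H) = h * ⟨g * (s (x g))⁻¹, hmem g⟩ := by
      ext; simp [h0, mul_assoc]
    rw [e, hfm, h0, mul_assoc (h : G), map_mul]
    ring
  · intro i
    have e : (⟨s i * (s (x (s i)))⁻¹, hmem (s i)⟩ : H) = 1 := by ext; simp [hs]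
    beta_reduce
    rw [e, hf1]
    simp [hs]

omit [TopologicalSpace G] [IsTopologicalGroup G] in
/-- The inverse of the Shapiro isomorphism on 1-cocycles.  The induced module is the module of
functions `φ : ℤ/p → R`, on which `g` acts by `(g φ) i = τ g * φ (i + x g)`. -/
lemma cocycle_of_extend {x : G → ZMod p} (hxm : ∀ g h, x (g * h) = x g + x h)
    {H : Subgroup G} (hH : ∀ g, g ∈ H ↔ x g = 0)
    {s : ZMod p → G} (hs : ∀ i, x (s i) = i) {τ : G →* R} {F : G → R}
    (hF : ∀ (h : H) (g : G), F (h * g) = F h + τ h * F g) (g k : G) (i : ZMod p) :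
    τ (s i)⁻¹ * (F (s i * (g * k)) - F (s i)) =
      τ (s i)⁻¹ * (F (s i * g) - F (s i)) +
        τ g * (τ (s (i + x g))⁻¹ * (F (s (i + x g) * k) - F (s (i + x g)))) := by
  set j := i + x g with hj
  have hmem : s i * g * (s j)⁻¹ ∈ H := by
    rw [hH, hxm, hxm, map_inv_of_additive hxm, hs, hs, hj, add_neg_cancel]
  obtain ⟨h, hh⟩ : ∃ h : H, (h : G) = s i * g * (s j)⁻¹ := ⟨⟨_, hmem⟩, rfl⟩
  have e1 : s i * (g * k) = h * (s j * k) := by rw [hh]; group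
  have e2 : s i * g = h * s j := by rw [hh]; group
  have e3 : τ (s i)⁻¹ * τ h = τ g * τ (s j)⁻¹ := by
    rw [← map_mul, ← map_mul, hh]; congr 1; group
  rw [e1, e2, hF, hF]
  linear_combination (F (s j * k) - F (s j)) * e3

/-- Shapiro's lemma in degree 2, in the form needed: a 2-cocycle with values in a trivial
module whose restriction to `H` is a coboundary becomes a coboundary in the induced module,
where it is viewed as a cocycle of constant functions. -/
lemma exists_cochain_of_res_eq_coboundary {x : G → ZMod p} (hx : IsLocallyConstant x)
    (hxm : ∀ g h, x (g * h) = x g + x h) {H : Subgroup G} (hH : ∀ g, g ∈ H ↔ x g = 0)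
    {s : ZMod p → G} (hs : ∀ i, x (s i) = i) (hs0 : s 0 = 1)
    {z : G × G → R} (hz : IsLocallyConstant z)
    (hzm : ∀ g h k, z (h, k) - z (g * h, k) + z (g, h * k) - z (g, h) = 0)
    {β : H → R} (hβ : IsLocallyConstant β)
    (hβz : ∀ g h : H, β h - β (g * h) + β g = z (g, h)) :
    ∃ F : G → ZMod p → R, (∀ i, IsLocallyConstant fun g => F g i) ∧
      ∀ g k i, F k (i + x g) - F (g * k) i + F g i = z (g, k) := by
  have hmem (g : G) : g * (s (x g))⁻¹ ∈ H := by
    rw [hH, hxm, map_inv_of_additive hxm, hs, add_neg_cancel]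
  have hcont : Continuous fun g : G => (⟨g * (s (x g))⁻¹, hmem g⟩ : H) :=
    (continuous_id.mul (hx.comp fun i => (s i)⁻¹).continuous).subtype_mk _
  -- `Φ` is to be the value at `0` of the cochain `F`; the constant `z (1, 1)` accounts for `z`
  -- not being normalized.
  obtain ⟨Φ, hΦ⟩ : ∃ Φ : G → R, ∀ g, Φ g =
      β ⟨g * (s (x g))⁻¹, hmem g⟩ - z (g * (s (x g))⁻¹, s (x g)) + z (1, 1) := ⟨_, fun _ => rfl⟩
  have hz1 (g : G) : z (g, 1) = z (1, 1) := by
    have := hzm g 1 1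
    simp only [mul_one, sub_add_cancel] at this
    exact (sub_eq_zero.1 this).symm
  have hΦH (h : H) : Φ h = β h := by
    have h0 : x h = 0 := (hH _).1 h.2
    rw [hΦ]
    simp only [h0, hs0, inv_one, mul_one, hz1, sub_add_cancel]
  have hΦl : IsLocallyConstant Φ := by
    have e : Φ = fun g => β ⟨g * (s (x g))⁻¹, hmem g⟩ - z (g * (s (x g))⁻¹, s (x g)) + z (1, 1) :=
      funext hΦ
    rw [e]
    refine ((hβ.comp_continuous hcont).sub ?_).add (IsLocallyConstant.const _)
    exact hz.comp_continuous
      ((continuous_subtype_val.comp hcont).prodMk (hx.comp s).continuous)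
  have hΦm (h : H) (g : G) : Φ g - Φ (h * g) + Φ h = z (h, g) := by
    have h0 : x (h * g) = x g := by rw [hxm, (hH _).1 h.2, zero_add]
    have e : (⟨h * g * (s (x (h * g)))⁻¹, hmem (h * g)⟩ : H) = h * ⟨g * (s (x g))⁻¹, hmem g⟩ := by
      ext; simp [h0, mul_assoc]
    have h1 := hβz h ⟨g * (s (x g))⁻¹, hmem g⟩
    have h2 := hzm h (g * (s (x g))⁻¹) (s (x g))
    rw [inv_mul_cancel_right] at h2
    rw [hΦH, hΦ g, hΦ (h * g), e, h0, mul_assoc (h : G)]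
    linear_combination h1 - h2
  refine ⟨fun g i => z (s i, g) + Φ (s i * g) - Φ (s i), fun i => ?_, fun g k i => ?_⟩
  · refine ((hz.comp_continuous (by fun_prop)).add (hΦl.comp_continuous ?_)).sub
      (IsLocallyConstant.const _)
    fun_prop
  · set j := i + x g with hj
    have hmem : s i * g * (s j)⁻¹ ∈ H := by
      rw [hH, hxm, hxm, map_inv_of_additive hxm, hs, hs, hj, add_neg_cancel]
    obtain ⟨h, hh⟩ : ∃ h : H, (h : G) = s i * g * (s j)⁻¹ := ⟨⟨_, hmem⟩, rfl⟩
    have e1 : s i * (g * k) = h * (s j * k) := by rw [hh]; group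
    have e2 : s i * g = h * s j := by rw [hh]; group
    have h1 := hΦm h (s j * k)
    have h2 := hΦm h (s j)
    have h3 := hzm h (s j) k
    have h4 := hzm (s i) g k
    beta_reduce
    rw [e1]
    rw [e2] at h4 ⊢
    linear_combination h1 - h2 + h3 - h4

end Induction

/-! ### The exact sequence from lifts of characters modulo `p²` -/

section Core

variable {p : ℕ} [Fact p.Prime] {G : Type u} [Group G] [TopologicalSpace G]

/-- Every locally constant character `K → ℤ/p` of an open subgroup `K` of `G` lifts to a
cocycle with values in `ℤ/p²`, on which `G` acts through `τ`.  When `τ ≡ 1` modulo `p`, this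
says that `H¹(K, ℤ/p²(τ)) → H¹(K, ℤ/p)` is surjective. -/
def LiftsCharacters (τ : G →* ZMod (p ^ 2)) : Prop :=
  ∀ K : Subgroup G, IsOpen (K : Set G) → ∀ f : K → ZMod p, IsLocallyConstant f →
    (∀ g h, f (g * h) = f g + f h) → ∃ f' : K → ZMod (p ^ 2), IsLocallyConstant f' ∧
      (∀ g h, f' (g * h) = f' g + τ g * f' h) ∧ ∀ g, redSq p (f' g) = f g

lemma LiftsCharacters.exists_lift {τ : G →* ZMod (p ^ 2)} (hl : LiftsCharacters τ)
    {a : G → ZMod p} (ha : IsLocallyConstant a) (ham : ∀ g h, a (g * h) = a g + a h) :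
    ∃ a' : G → ZMod (p ^ 2), IsLocallyConstant a' ∧
      (∀ g h, a' (g * h) = a' g + τ g * a' h) ∧ ∀ g, redSq p (a' g) = a g := by
  obtain ⟨f, hf, hfm, hfr⟩ := hl ⊤ isOpen_univ (fun g => a g)
    (ha.comp_continuous continuous_subtype_val) fun g h => ham g h
  exact ⟨fun g => f ⟨g, trivial⟩,
    hf.comp_continuous (f := fun g : G => (⟨g, trivial⟩ : (⊤ : Subgroup G))) (by fun_prop),
    fun g h => hfm ⟨g, trivial⟩ ⟨h, trivial⟩, fun g => hfr ⟨g, trivial⟩⟩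

lemma sum_comp_add_right {A : Type*} [AddCommMonoid A] (φ : ZMod p → A) (j : ZMod p) :
    ∑ i, φ (i + j) = ∑ i, φ i :=
  Equiv.sum_comp (Equiv.addRight j) φ

/-- The first moment `∑ i, i * φ i` of a cochain with values in the functions `ℤ/p → ℤ/p`
turns the coboundary of the cochain into a coboundary plus a cup product with `x`. -/
lemma sum_mul_shift (φ : ZMod p → ZMod p) (j : ZMod p) :
    ∑ i, i * φ (i + j) = ∑ i, i * φ i - j * ∑ i, φ i := by
  rw [← sum_comp_add_right (fun i => i * φ i) j, ← sum_comp_add_right φ j, Finset.mul_sum,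
    ← Finset.sum_sub_distrib]
  exact Finset.sum_congr rfl fun i _ => by ring

section NoTopologicalGroup

variable {x : G → ZMod p} (hx : IsLocallyConstant x) (hxm : ∀ g h, x (g * h) = x g + x h)
include hx hxm

/-- Characters of the form `∑ i, y · i`, with `y` a cocycle in the induced module, have trivial
cup product with `x`. -/
lemma cup_sum_eq_coboundary {y : G → ZMod p → ZMod p}
    (hy : ∀ i, IsLocallyConstant fun g => y g i)
    (hym : ∀ g k i, y (g * k) i = y g i + y k (i + x g)) :
    ∃ b : G → ZMod p, IsLocallyConstant b ∧
      ∀ g k, b k - b (g * k) + b g = (∑ i, y g i) * x k := by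
  have hs (g k : G) : ∑ i, y (g * k) i = ∑ i, y g i + ∑ i, y k i := by
    simp only [hym, Finset.sum_add_distrib, sum_comp_add_right]
  have hm (g k : G) : ∑ i, i * y (g * k) i =
      ∑ i, i * y g i + (∑ i, i * y k i - x g * ∑ i, y k i) := by
    simp only [hym, mul_add, Finset.sum_add_distrib, sum_mul_shift]
  -- the first moment trivializes `x ∪ ∑ i, y · i`; the product `x * ∑ i, y · i` swaps the factors
  refine ⟨fun g => -(∑ i, i * y g i) - x g * ∑ i, y g i, ?_, fun g k => ?_⟩
  · exact ((IsLocallyConstant.fintype_sum fun i => (hy i).comp (i * ·)).neg).sub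
      (hx.mul (IsLocallyConstant.fintype_sum hy))
  · beta_reduce
    rw [hm, hs, hxm]
    ring

end NoTopologicalGroup

variable [IsTopologicalGroup G]
  {x : G → ZMod p} (hx : IsLocallyConstant x) (hxm : ∀ g h, x (g * h) = x g + x h)
  {H : Subgroup G} (hH : ∀ g, g ∈ H ↔ x g = 0) (hHo : IsOpen (H : Set G))
  {s : ZMod p → G} (hs : ∀ i, x (s i) = i) (hs0 : s 0 = 1)
  {τ : G →* ZMod (p ^ 2)} (hτ : IsLocallyConstant τ) (hτ1 : ∀ g, redSq p (τ g) = 1)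
  (hl : LiftsCharacters τ)

include hx hxm hH hs hs0 in
/-- Every character of `H` is the evaluation at `0` of a cocycle in the induced module. -/
lemma exists_induced_cocycle {c : H → ZMod p} (hc : IsLocallyConstant c)
    (hcm : ∀ g h, c (g * h) = c g + c h) :
    ∃ y : G → ZMod p → ZMod p, (∀ i, IsLocallyConstant fun g => y g i) ∧
      (∀ g k i, y (g * k) i = y g i + y k (i + x g)) ∧ ∀ h : H, y h 0 = c h := by
  obtain ⟨F, hF, hFm, hFH, -⟩ := exists_extend_cocycle hx hxm hH hs hs0 (τ := (1 : G →* ZMod p))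
    (IsLocallyConstant.const 1) hc (by simpa using hcm) (fun _ => 0) rfl
  refine ⟨fun g i => F (s i * g) - F (s i), fun i => ?_, fun g k i => ?_, fun h => ?_⟩
  · exact (hF.comp_continuous (by fun_prop)).sub (IsLocallyConstant.const _)
  · simpa using cocycle_of_extend hxm hH hs hFm g k i
  · have h1 : c 1 = 0 := by simpa using hcm 1 1
    have : F (1 : G) = 0 := by simpa [h1] using hFH 1
    simp [hs0, hFH, this]

include hx hxm hH hHo hs hs0 hτ hτ1 hl in
/-- Lifting characters of `H` amounts to lifting cocycles in the induced module. -/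
lemma exists_lift_induced {y : G → ZMod p → ZMod p}
    (hy : ∀ i, IsLocallyConstant fun g => y g i)
    (hym : ∀ g k i, y (g * k) i = y g i + y k (i + x g)) :
    ∃ u : G → ZMod p → ZMod (p ^ 2), (∀ i, IsLocallyConstant fun g => u g i) ∧
      (∀ g k i, u (g * k) i = u g i + τ g * u k (i + x g)) ∧ ∀ g i, redSq p (u g i) = y g i := by
  have hxH (h : H) : x h = 0 := (hH _).1 h.2
  have hy1 : y 1 0 = 0 := by
    have := hym 1 1 0
    rw [show x 1 = 0 from hxH 1, mul_one, add_zero] at this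
    simpa using this
  obtain ⟨f, hf, hfm, hfr⟩ := hl H hHo (fun h => y h 0)
    ((hy 0).comp_continuous continuous_subtype_val)
    fun g h => by simpa [hxH] using hym g h 0
  obtain ⟨F, hF, hFm, hFH, hFs⟩ := exists_extend_cocycle hx hxm hH hs hs0 hτ hf hfm
    (fun i => liftSq p (y (s i) 0)) (by simp [hs0, hy1])
  have hFr (g : G) : redSq p (F g) = y g 0 := by
    have hmem : g * (s (x g))⁻¹ ∈ H := by
      rw [hH, hxm, map_inv_of_additive hxm, hs, add_neg_cancel]
    have e : g = (⟨_, hmem⟩ : H) * s (x g) := by simp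
    have h1 := hFm ⟨_, hmem⟩ (s (x g))
    have h2 := hym (⟨_, hmem⟩ : H) (s (x g)) 0
    rw [hxH, add_zero] at h2
    rw [← e] at h1 h2
    rw [h1, h2, map_add, map_mul, hτ1, hFH, hfr, hFs, redSq_liftSq, one_mul]
  refine ⟨fun g i => τ (s i)⁻¹ * (F (s i * g) - F (s i)), fun i => ?_, fun g k i =>
    cocycle_of_extend hxm hH hs hFm g k i, fun g i => ?_⟩
  · exact ((hF.comp_continuous (f := fun g => s i * g) (by fun_prop)).sub
      (IsLocallyConstant.const _)).comp (τ (s i)⁻¹ * ·)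
  · rw [map_mul, map_sub, hτ1, hFr, hFr, hym, hs]
    simp

include hx hxm hH hHo hs hs0 hτ hτ1 hl in
/-- Cocycle form of exactness at `H¹(G, ℤ/p)`.  A trivialization `b` of `a ∪ x` makes
`i ↦ i * a + b + x * a` a cocycle in the induced module; it and `a` lift modulo `p²`, and
comparing the lifts exhibits `a` as the sum over `i` of a cocycle in the induced module. -/
lemma exists_sum_eq_of_cup_eq_coboundary {a : G → ZMod p} (ha : IsLocallyConstant a)
    (ham : ∀ g h, a (g * h) = a g + a h) {b : G → ZMod p} (hb : IsLocallyConstant b)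
    (hab : ∀ g k, b k - b (g * k) + b g = a g * x k) :
    ∃ y : G → ZMod p → ZMod p, (∀ i, IsLocallyConstant fun g => y g i) ∧
      (∀ g k i, y (g * k) i = y g i + y k (i + x g)) ∧ ∀ g, ∑ i, y g i = a g := by
  obtain ⟨u, hu, hum, hur⟩ := exists_lift_induced hx hxm hH hHo hs hs0 hτ hτ1 hl
    (y := fun g i => i * a g + (b g + x g * a g))
    (fun i => (ha.comp (i * ·)).add (hb.add (hx.mul ha)))
    (fun g k i => by
      rw [ham, hxm]
      linear_combination -hab g k)
  obtain ⟨a', ha', ham', har'⟩ := hl.exists_lift ha ham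
  have hred (g : G) (i : ZMod p) : redSq p (u g (i + 1) - u g i - a' g) = 0 := by
    rw [map_sub, map_sub, hur, hur, har']
    ring
  have hc (g : G) (i : ZMod p) := natCast_mul_divSq (hred g i)
  refine ⟨fun g i => -redSq p (divSq p (u g (i + 1) - u g i - a' g)), fun i => ?_,
    fun g k i => ?_, fun g => ?_⟩
  · exact (((hu (i + 1)).sub (hu i)).sub ha').comp fun w => -redSq p (divSq p w)
  · have key : (p : ZMod (p ^ 2)) * divSq p (u (g * k) (i + 1) - u (g * k) i - a' (g * k)) =
        (p : ZMod (p ^ 2)) * (divSq p (u g (i + 1) - u g i - a' g) +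
          τ g * divSq p (u k (i + x g + 1) - u k (i + x g) - a' k)) := by
      rw [mul_add, mul_left_comm, hc, hc, hc, hum, hum, ham', add_right_comm i 1]
      ring
    rw [natCast_mul_eq_iff, map_add, map_mul, hτ1, one_mul] at key
    beta_reduce
    rw [key]
    ring
  · have key : (p : ZMod (p ^ 2)) * ∑ i, divSq p (u g (i + 1) - u g i - a' g) =
        (p : ZMod (p ^ 2)) * (-a' g) := by
      rw [Finset.mul_sum]
      simp only [hc, Finset.sum_sub_distrib, sum_comp_add_right]
      simp [ZMod.card]
    rw [natCast_mul_eq_iff, map_sum, map_neg, har'] at key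
    rw [Finset.sum_neg_distrib, key, neg_neg]

include hx hxm hH hHo hs hs0 hτ hτ1 hl in
/-- Cocycle form of exactness at `H²(G, ℤ/p)`.  By Shapiro's lemma the cocycle `z` is the
coboundary of a cochain `F` in the induced module.  The difference `F (i + 1) - F i` is then
a cocycle and lifts modulo `p²`; the sum over `i` of the lift is `p` times a character `a`.
Comparing with the coboundary of a set-theoretic lift of `F` shows that `z` is cohomologous to
`x ∪ a`, up to the Bockstein of the character `∑ i, F i`, which vanishes because characters
of `G` lift. -/
lemma exists_eq_cup_add_coboundary {z : G × G → ZMod p} (hz : IsLocallyConstant z)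
    (hzm : ∀ g h k, z (h, k) - z (g * h, k) + z (g, h * k) - z (g, h) = 0)
    {β : H → ZMod p} (hβ : IsLocallyConstant β)
    (hβz : ∀ g h : H, β h - β (g * h) + β g = z (g, h)) :
    ∃ a b : G → ZMod p, IsLocallyConstant a ∧ (∀ g h, a (g * h) = a g + a h) ∧
      IsLocallyConstant b ∧ ∀ g k, b k - b (g * k) + b g = z (g, k) - a g * x k := by
  obtain ⟨F, hF, hFz⟩ := exists_cochain_of_res_eq_coboundary hx hxm hH hs hs0 hz hzm hβ hβz
  obtain ⟨u, hu, hum, hur⟩ := exists_lift_induced hx hxm hH hHo hs hs0 hτ hτ1 hl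
    (y := fun g i => F g (i + 1) - F g i) (fun i => (hF _).sub (hF _))
    (fun g k i => by
      have h1 := hFz g k i
      have h2 := hFz g k (i + 1)
      rw [add_right_comm] at h2
      linear_combination h1 - h2)
  -- the lift `F'` of `F`, and `u = t F' + p c` where `t` is the difference operator
  obtain ⟨F', hF', hFr'⟩ : ∃ F' : G → ZMod p → ZMod (p ^ 2),
      (∀ i, IsLocallyConstant fun g => F' g i) ∧ ∀ g i, redSq p (F' g i) = F g i :=
    ⟨fun g i => liftSq p (F g i), fun i => (hF i).comp (liftSq p), fun g i => redSq_liftSq _⟩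
  obtain ⟨c, hcl, hc⟩ : ∃ c : G → ZMod p → ZMod (p ^ 2), (∀ i, IsLocallyConstant fun g => c g i) ∧
      ∀ g i, (p : ZMod (p ^ 2)) * c g i = u g i - (F' g (i + 1) - F' g i) :=
    ⟨fun g i => divSq p (u g i - (F' g (i + 1) - F' g i)),
      fun i => ((hu i).sub ((hF' (i + 1)).sub (hF' i))).comp (divSq p),
      fun g i => natCast_mul_divSq (by rw [map_sub, map_sub, hur, hFr', hFr', sub_self])⟩
  -- the coboundary of `F'` is `z' + p e`, with `z'` a lift of `z`
  obtain ⟨e, he⟩ : ∃ e : G → G → ZMod p → ZMod (p ^ 2), ∀ g k i, (p : ZMod (p ^ 2)) * e g k i =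
      τ g * F' k (i + x g) - F' (g * k) i + F' g i - liftSq p (z (g, k)) :=
    ⟨fun g k i => divSq p (τ g * F' k (i + x g) - F' (g * k) i + F' g i - liftSq p (z (g, k))),
      fun g k i => natCast_mul_divSq (by
        rw [map_sub, map_add, map_sub, map_mul, hτ1, hFr', hFr', hFr', redSq_liftSq, one_mul,
          hFz, sub_self])⟩
  have hpc (g : G) : (p : ZMod (p ^ 2)) * ∑ i, c g i = ∑ i, u g i := by
    simp only [Finset.mul_sum, hc, Finset.sum_sub_distrib, sum_comp_add_right]
    simp
  obtain ⟨a, ha⟩ : ∃ a : G → ZMod p, ∀ g, a g = ∑ i, redSq p (c g i) := ⟨_, fun _ => rfl⟩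
  have hal : IsLocallyConstant a := by
    rw [show a = _ from funext ha]
    exact IsLocallyConstant.fintype_sum fun i => (hcl i).comp _
  have ham (g k : G) : a (g * k) = a g + a k := by
    have key : (p : ZMod (p ^ 2)) * ∑ i, c (g * k) i =
        (p : ZMod (p ^ 2)) * (∑ i, c g i + τ g * ∑ i, c k i) := by
      rw [mul_add, mul_left_comm, hpc, hpc, hpc]
      simp only [hum, Finset.sum_add_distrib, ← Finset.mul_sum, sum_comp_add_right]
    rw [natCast_mul_eq_iff, map_add, map_mul, hτ1, one_mul] at key
    simpa only [map_sum, ha] using key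
  -- the first moment of `t e + d c = 0` computes `∑ i, e i`
  have hte (g k : G) (i : ZMod p) : redSq p (e g k (i + 1)) - redSq p (e g k i) =
      -(redSq p (c k (i + x g)) - redSq p (c (g * k) i) + redSq p (c g i)) := by
    have key : (p : ZMod (p ^ 2)) * (e g k (i + 1) - e g k i) =
        (p : ZMod (p ^ 2)) * (-(τ g * c k (i + x g) - c (g * k) i + c g i)) := by
      have h1 := hum g k i
      simp only [mul_sub, mul_neg, mul_add, mul_left_comm _ (τ g), he, hc,
        add_right_comm i 1 (x g)]
      linear_combination -h1
    rw [natCast_mul_eq_iff] at key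
    simpa only [map_sub, map_neg, map_add, map_mul, hτ1, one_mul] using key
  obtain ⟨m, hm⟩ : ∃ m : G → ZMod p, ∀ g, m g = ∑ i, i * redSq p (c g i) := ⟨_, fun _ => rfl⟩
  have hml : IsLocallyConstant m := by
    rw [show m = _ from funext hm]
    exact IsLocallyConstant.fintype_sum fun i => (hcl i).comp fun w => i * redSq p w
  have hse (g k : G) : ∑ i, redSq p (e g k i) = m k - m (g * k) + m g - x g * a k := by
    have h1 := sum_mul_shift (fun i => redSq p (e g k i)) 1
    have h2 := sum_mul_shift (fun i => redSq p (c k i)) (x g)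
    have h3 : ∑ i, i * (redSq p (e g k (i + 1)) - redSq p (e g k i)) =
        -(∑ i, i * redSq p (c k (i + x g)) - m (g * k) + m g) := by
      simp only [hte, hm, ← Finset.sum_sub_distrib, ← Finset.sum_add_distrib,
        ← Finset.sum_neg_distrib]
      exact Finset.sum_congr rfl fun i _ => by ring
    rw [h2, ← hm, ← ha] at h3
    simp only [mul_sub, Finset.sum_sub_distrib] at h3
    linear_combination -h3 + h1
  -- `∑ i, F i` is a character, so it lifts to a cocycle `f'`, and `∑ i, F' i = f' + p q`
  have hfm (g k : G) : ∑ i, F (g * k) i = ∑ i, F g i + ∑ i, F k i := by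
    have : ∑ i, (F k (i + x g) - F (g * k) i + F g i) = ∑ _i : ZMod p, z (g, k) :=
      Finset.sum_congr rfl fun i _ => hFz g k i
    rw [Finset.sum_add_distrib, Finset.sum_sub_distrib, sum_comp_add_right] at this
    simp only [Finset.sum_const, Finset.card_univ, ZMod.card, nsmul_eq_mul, CharP.cast_eq_zero,
      zero_mul] at this
    linear_combination -this
  obtain ⟨f', hf', hfm', hfr'⟩ := hl.exists_lift (IsLocallyConstant.fintype_sum hF) hfm
  obtain ⟨q, hql, hq⟩ : ∃ q : G → ZMod (p ^ 2), IsLocallyConstant q ∧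
      ∀ g, (p : ZMod (p ^ 2)) * q g = ∑ i, F' g i - f' g :=
    ⟨fun g => divSq p (∑ i, F' g i - f' g),
      ((IsLocallyConstant.fintype_sum hF').sub hf').comp (divSq p),
      fun g => natCast_mul_divSq (by rw [map_sub, map_sum, hfr']; simp [hFr'])⟩
  have hqz (g k : G) : redSq p (q k) - redSq p (q (g * k)) + redSq p (q g) =
      z (g, k) + ∑ i, redSq p (e g k i) := by
    have key : (p : ZMod (p ^ 2)) * (τ g * q k - q (g * k) + q g) =
        (p : ZMod (p ^ 2)) * (liftSq p (z (g, k)) + ∑ i, e g k i) := by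
      have h1 := hfm' g k
      rw [mul_add, mul_add, mul_sub, mul_left_comm, hq, hq, hq, Finset.mul_sum]
      simp only [he, Finset.sum_sub_distrib, Finset.sum_add_distrib, ← Finset.mul_sum,
        sum_comp_add_right]
      simp only [Finset.sum_const, Finset.card_univ, ZMod.card, nsmul_eq_mul]
      linear_combination h1
    rw [natCast_mul_eq_iff] at key
    simpa only [map_sub, map_sum, map_add, map_mul, hτ1, one_mul, redSq_liftSq] using key
  -- `z` is `x ∪ a` up to a coboundary, and `x ∪ a = -a ∪ x` up to the coboundary of `x * a`
  refine ⟨fun g => -a g, fun g => redSq p (q g) - m g - x g * a g, hal.neg, fun g k => ?_, ?_,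
    fun g k => ?_⟩
  · beta_reduce
    rw [ham, neg_add]
  · exact ((hql.comp (redSq p)).sub hml).sub (hx.mul hal)
  · have h1 := hqz g k
    rw [hse] at h1
    beta_reduce
    rw [hxm, ham]
    linear_combination h1

end Core

/-! ### Corestriction and exactness -/

section Corestriction

variable {G : Type u} [Group G]

lemma cor_apply [TopologicalSpace G] [IsTopologicalGroup G] [CompactSpace G] {A : Type v} [AddCommGroup A] (ρ : Representation ℤ G A) {H : Subgroup G}
    (hH : IsOpen (H : Set G)) [inst : Fintype (G ⧸ H)] (c : Z1 (resRep ρ H))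
    (g : G) :
    (Z1.cor ρ H hH c).1 g = ∑ x : G ⧸ H, ρ (g • x).out (c.1 (transversalElt H g x)) := by
  have : Finite (G ⧸ H) := H.quotient_finite_of_isOpen hH
  obtain rfl : inst = Fintype.ofFinite _ := Subsingleton.elim _ _
  rfl

/-- Corestriction after restriction is multiplication by the index; with trivial action this
holds for cocycles. -/
lemma sum_transversalElt_res {A : Type v} [AddCommGroup A] {a : G → A}
    (ham : ∀ g h, a (g * h) = a g + a h) (H : Subgroup G) [Fintype (G ⧸ H)] (g : G) :
    ∑ x : G ⧸ H, a (transversalElt H g x) = H.index • a g := by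
  have key (x : G ⧸ H) : a (transversalElt H g x) = a g + (a x.out - a (g • x).out) := by
    change a (((g • x).out)⁻¹ * g * x.out) = _
    rw [ham, ham, map_inv_of_additive ham]
    abel
  have := Equiv.sum_comp (MulAction.toPerm g) fun x : G ⧸ H => a x.out
  simp only [MulAction.toPerm_apply] at this
  simp only [key, Finset.sum_add_distrib, Finset.sum_sub_distrib, this, sub_self, add_zero,
    Finset.sum_const, Finset.card_univ, Subgroup.index, Nat.card_eq_fintype_card]

/-- The corestriction of the character of `H` that corresponds to a cocycle `y` in the
induced module is `∑ i, y · i`. -/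
lemma sum_transversalElt_eq_sum {p : ℕ} [Fact p.Prime] {x : G → ZMod p}
    (hxm : ∀ g h, x (g * h) = x g + x h) {H : Subgroup G} (hH : ∀ g, g ∈ H ↔ x g = 0)
    (hsurj : Function.Surjective x) [Fintype (G ⧸ H)] {A : Type*} [AddCommGroup A]
    {y : G → ZMod p → A} (hym : ∀ g k i, y (g * k) i = y g i + y k (i + x g)) (g : G) :
    ∑ q : G ⧸ H, y (transversalElt H g q) 0 = ∑ i, y g i := by
  have hx (q : G ⧸ H) (k : G) (hk : (k : G ⧸ H) = q) : x q.out = x k := by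
    have : q.out⁻¹ * k ∈ H := by rw [← QuotientGroup.eq, QuotientGroup.out_eq', hk]
    rw [hH, hxm, map_inv_of_additive hxm] at this
    exact (neg_add_eq_zero.1 this)
  have hbij : Function.Bijective fun q : G ⧸ H => -x q.out := by
    refine ⟨fun q r h => ?_, fun i => ?_⟩
    · have h' : x q.out = x r.out := neg_injective h
      rw [← QuotientGroup.out_eq' q, ← QuotientGroup.out_eq' r, QuotientGroup.eq, hH, hxm,
        map_inv_of_additive hxm, h', neg_add_cancel]
    · obtain ⟨k, hk⟩ := hsurj (-i)
      exact ⟨(k : G ⧸ H), by beta_reduce; rw [hx _ k rfl, hk, neg_neg]⟩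
  have key (q : G ⧸ H) : y (transversalElt H g q) 0 =
      y g (-x (g • q).out) + (y (g • q).out⁻¹ 0 - y q.out⁻¹ 0) := by
    have h1 := hym (transversalElt H g q) q.out⁻¹ 0
    have h2 := hym (g • q).out⁻¹ g 0
    have e : (transversalElt H g q : G) * q.out⁻¹ = (g • q).out⁻¹ * g := by
      simp [transversalElt]
    rw [(hH _).1 (transversalElt H g q).2, add_zero, e, h2, map_inv_of_additive hxm,
      zero_add] at h1
    rw [eq_sub_of_add_eq h1.symm]
    abel
  have hperm (φ : G ⧸ H → A) : ∑ q, φ (g • q) = ∑ q, φ q :=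
    Equiv.sum_comp (MulAction.toPerm g) φ
  simp only [key, Finset.sum_add_distrib, Finset.sum_sub_distrib]
  rw [hperm (fun q => y q.out⁻¹ 0), sub_self, add_zero, hperm (fun q => y g (-x q.out))]
  exact Fintype.sum_bijective _ hbij _ _ fun _ => rfl

end Corestriction

section Exactness

variable {p : ℕ} {G : Type u} [Group G] [TopologicalSpace G]

lemma H1.mk_trivial_injective : Function.Injective (H1.mk (trivZMod p G)) := by
  rw [injective_iff_map_eq_zero]
  intro a ha
  exact eq_zero_of_mem_B1_trivial ((QuotientAddGroup.eq_zero_iff a).1 ha)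

lemma H1.mk_surjective {A : Type v} [AddCommGroup A] (ρ : Representation ℤ G A) :
    Function.Surjective (H1.mk ρ) :=
  QuotientAddGroup.mk'_surjective _

lemma H2.mk_surjective {A : Type v} [AddCommGroup A] (ρ : Representation ℤ G A) :
    Function.Surjective (H2.mk ρ) :=
  QuotientAddGroup.mk'_surjective _

lemma H2.mk_eq_zero_iff {z : Z2 (trivZMod p G)} :
    H2.mk _ z = 0 ↔ ∃ b : G → ZMod p, IsLocallyConstant b ∧
      ∀ g k, b k - b (g * k) + b g = z.1 (g, k) :=
  (QuotientAddGroup.eq_zero_iff z).trans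
    ⟨fun ⟨b, hb, h⟩ => ⟨b, hb, fun g k => congrFun h (g, k)⟩,
      fun ⟨b, hb, h⟩ => ⟨b, hb, funext fun y => h y.1 y.2⟩⟩

variable (χ : G →ₜ* Multiplicative (ZMod p))

lemma cupChar_mk_eq_zero_iff (a : Z1 (trivZMod p G)) :
    cupChar χ (H1.mk _ a) = 0 ↔ ∃ b : G → ZMod p, IsLocallyConstant b ∧
      ∀ g k, b k - b (g * k) + b g = a.1 g * (χ k).toAdd :=
  H2.mk_eq_zero_iff (z := Z1.cup (ZMod p) a (charZ1 χ))

lemma resKer_mk_eq_zero_iff (z : Z2 (trivZMod p G)) :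
    resKer χ (H2.mk _ z) = 0 ↔ ∃ b : charKer χ → ZMod p, IsLocallyConstant b ∧
      ∀ g k, b k - b (g * k) + b g = z.1 (g, k) :=
  (QuotientAddGroup.eq_zero_iff (Z2.res (trivZMod p G) (charKer χ) z)).trans
    ⟨fun ⟨b, hb, h⟩ => ⟨b, hb, fun g k => congrFun h (g, k)⟩,
      fun ⟨b, hb, h⟩ => ⟨b, hb, funext fun y => h y.1 y.2⟩⟩

lemma mem_charKer_iff (g : G) : g ∈ charKer χ ↔ (χ g).toAdd = 0 := by
  rw [MonoidHom.mem_ker]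
  exact toAdd_eq_zero.symm

variable [Fact p.Prime]

/-- A nontrivial character is surjective, with a normalized section. -/
lemma exists_section_of_ne_one (hχ : ∃ g, χ g ≠ 1) :
    ∃ s : ZMod p → G, (∀ i, (χ (s i)).toAdd = i) ∧ s 0 = 1 := by
  obtain ⟨g, hg⟩ := hχ
  have hg' : (χ g).toAdd ≠ 0 := fun h => hg (toAdd_eq_zero.1 h)
  refine ⟨fun i => g ^ (i * (χ g).toAdd⁻¹).val, fun i => ?_, by simp⟩
  rw [map_pow, toAdd_pow, nsmul_eq_mul, ZMod.natCast_zmod_val, inv_mul_cancel_right₀ hg']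

variable [IsTopologicalGroup G]

lemma corKer_mk_eq_iff [CompactSpace G] (c : Z1 (trivZMod p (charKer χ))) (a : Z1 (trivZMod p G))
    [Fintype (G ⧸ charKer χ)] : corKer χ (H1.mk _ c) = H1.mk _ a ↔
      ∀ g, ∑ q : G ⧸ charKer χ, c.1 (transversalElt _ g q) = a.1 g := by
  change H1.mk _ (Z1.cor (trivZMod p G) (charKer χ) (isOpen_charKer χ) c) = _ ↔ _
  rw [H1.mk_trivial_injective.eq_iff, Subtype.ext_iff, funext_iff]
  exact forall_congr' fun g => Eq.congr_left
    (cor_apply (trivZMod p G) (isOpen_charKer χ) c g)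

theorem exact_corKer_cupChar [CompactSpace G] {τ : G →* ZMod (p ^ 2)} (hτ : IsLocallyConstant τ)
    (hτ1 : ∀ g, redSq p (τ g) = 1) (hl : LiftsCharacters τ) :
    Function.Exact (corKer χ) (cupChar χ) := by
  classical
  have : Finite (G ⧸ charKer χ) := Subgroup.quotient_finite_of_isOpen _ (isOpen_charKer χ)
  let _ : Fintype (G ⧸ charKer χ) := Fintype.ofFinite _
  have hx : IsLocallyConstant fun g => (χ g).toAdd := (charZ1 χ).2.1
  have hxm (g h : G) : (χ (g * h)).toAdd = (χ g).toAdd + (χ h).toAdd := by simp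
  intro y
  obtain ⟨a, rfl⟩ := H1.mk_surjective _ y
  rw [cupChar_mk_eq_zero_iff]
  have ham : ∀ g h, a.1 (g * h) = a.1 g + a.1 h := a.2.2
  by_cases hχ : ∃ g, χ g ≠ 1
  · obtain ⟨s, hs, hs0⟩ := exists_section_of_ne_one χ hχ
    have hsurj : Function.Surjective fun g => (χ g).toAdd := fun i => ⟨s i, hs i⟩
    constructor
    · rintro ⟨b, hb, hab⟩
      obtain ⟨y, hy, hym, hya⟩ := exists_sum_eq_of_cup_eq_coboundary hx hxm (mem_charKer_iff χ)
        (isOpen_charKer χ) hs hs0 hτ hτ1 hl a.2.1 ham hb hab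
      have hym0 (g h : charKer χ) : y (g * h) 0 = y g 0 + y h 0 := by
        have := hym g h 0
        rwa [(mem_charKer_iff χ _).1 g.2, add_zero] at this
      refine ⟨H1.mk _ ⟨fun h => y h 0, (hy 0).comp_continuous continuous_subtype_val, hym0⟩, ?_⟩
      rw [corKer_mk_eq_iff]
      intro g
      rw [← hya]
      exact sum_transversalElt_eq_sum hxm (mem_charKer_iff χ) hsurj hym g
    · rintro ⟨c, hc⟩
      obtain ⟨c, rfl⟩ := H1.mk_surjective _ c
      rw [corKer_mk_eq_iff] at hc
      obtain ⟨y, hy, hym, hyc⟩ := exists_induced_cocycle hx hxm (mem_charKer_iff χ) hs hs0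
        c.2.1 c.2.2
      obtain ⟨b, hb, hb'⟩ := cup_sum_eq_coboundary hx hxm hy hym
      refine ⟨b, hb, fun g k => ?_⟩
      rw [hb', ← hc, ← sum_transversalElt_eq_sum hxm (mem_charKer_iff χ) hsurj hym g]
      simp only [hyc]
  · -- for `χ = 1` the corestriction is an isomorphism and the cup product is zero
    have h1 (g : G) : (χ g).toAdd = 0 := toAdd_eq_zero.2 (not_not.1 fun h => hχ ⟨g, h⟩)
    refine iff_of_true ⟨0, IsLocallyConstant.const 0, by simp [h1]⟩ ?_
    refine ⟨H1.mk _ ⟨fun h => a.1 h, a.2.1.comp_continuous continuous_subtype_val,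
      fun g h => ham g h⟩, ?_⟩
    rw [corKer_mk_eq_iff]
    intro g
    have htop : charKer χ = ⊤ := by
      ext g
      rw [mem_charKer_iff]
      simp only [h1, Subgroup.mem_top]
    refine (sum_transversalElt_res ham _ g).trans ?_
    rw [htop, Subgroup.index_top, one_smul]

theorem exact_cupChar_resKer {τ : G →* ZMod (p ^ 2)} (hτ : IsLocallyConstant τ)
    (hτ1 : ∀ g, redSq p (τ g) = 1) (hl : LiftsCharacters τ) :
    Function.Exact (cupChar χ) (resKer χ) := by
  have hx : IsLocallyConstant fun g => (χ g).toAdd := (charZ1 χ).2.1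
  have hxm (g h : G) : (χ (g * h)).toAdd = (χ g).toAdd + (χ h).toAdd := by simp
  intro y
  obtain ⟨z, rfl⟩ := H2.mk_surjective _ y
  rw [resKer_mk_eq_zero_iff]
  have hzm : ∀ g h k, z.1 (h, k) - z.1 (g * h, k) + z.1 (g, h * k) - z.1 (g, h) = 0 := z.2.2
  have hcup (a : Z1 (trivZMod p G)) : cupChar χ (H1.mk _ a) = H2.mk _ z ↔
      ∃ b : G → ZMod p, IsLocallyConstant b ∧
        ∀ g k, b k - b (g * k) + b g = z.1 (g, k) - a.1 g * (χ k).toAdd := by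
    rw [eq_comm, ← sub_eq_zero]
    exact H2.mk_eq_zero_iff (z := z - Z1.cup (ZMod p) a (charZ1 χ))
  constructor
  · rintro ⟨β, hβ, hβz⟩
    by_cases hχ : ∃ g, χ g ≠ 1
    · obtain ⟨s, hs, hs0⟩ := exists_section_of_ne_one χ hχ
      obtain ⟨a, b, ha, ham, hb, hab⟩ := exists_eq_cup_add_coboundary hx hxm (mem_charKer_iff χ)
        (isOpen_charKer χ) hs hs0 hτ hτ1 hl z.2.1 hzm hβ hβz
      exact ⟨H1.mk _ ⟨a, ha, ham⟩, (hcup _).2 ⟨b, hb, hab⟩⟩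
    · have h1 (g : G) : g ∈ charKer χ := not_not.1 fun h => hχ ⟨g, h⟩
      refine ⟨H1.mk _ 0, (hcup _).2 ⟨fun g => β ⟨g, h1 g⟩,
        hβ.comp_continuous (f := fun g => (⟨g, h1 g⟩ : charKer χ)) (by fun_prop), fun g k => ?_⟩⟩
      have := hβz ⟨g, h1 g⟩ ⟨k, h1 k⟩
      simpa using this
  · rintro ⟨a, ha⟩
    obtain ⟨a, rfl⟩ := H1.mk_surjective _ a
    obtain ⟨b, hb, hb'⟩ := (hcup a).1 ha
    refine ⟨fun g => b g, hb.comp_continuous continuous_subtype_val, fun g k => ?_⟩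
    have := hb' g k
    rwa [(mem_charKer_iff χ _).1 k.2, mul_zero, sub_zero] at this

end Exactness

/-! ### Removing the twist modulo `p` -/

section Untwist

variable {p : ℕ} [Fact p.Prime] {G : Type u} [Group G]

/-- The module `R` on which `G` acts by multiplication through a character `τ`. -/
def mulRep {R : Type*} [CommRing R] (τ : G →* R) : Representation ℤ G R where
  toFun g := (AddMonoidHom.mulLeft (τ g)).toIntLinearMap
  map_one' := by ext x; simp
  map_mul' g h := by ext x; simp [mul_assoc]

lemma redSq_pow_sub_one_sq (σ : G →* ZMod (p ^ 2)) (g : G) :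
    redSq p ((σ ^ (p - 1) ^ 2) g) = 1 := by
  have hu : IsUnit (redSq p (σ g)) := ((Group.isUnit g).map σ).map (redSq p)
  rw [MonoidHom.pow_apply, map_pow, pow_two (p - 1), pow_mul,
    ZMod.pow_card_sub_one_eq_one hu.ne_zero, one_pow]

lemma pow_sub_one_sq_of_redSq_eq_one {w : ZMod (p ^ 2)} (hw : redSq p w = 1) :
    w ^ (p - 1) ^ 2 = w := by
  obtain ⟨y, hy⟩ : ∃ y, (p : ZMod (p ^ 2)) * y = w - 1 :=
    ⟨_, natCast_mul_divSq (by rw [map_sub, hw, map_one, sub_self])⟩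
  have hpp : (p : ZMod (p ^ 2)) * p = 0 := by
    rw [← Nat.cast_mul, ← pow_two, ZMod.natCast_self]
  have hpow (n : ℕ) : w ^ n = 1 + (p : ZMod (p ^ 2)) * (n * y) := by
    induction n with
    | zero => simp
    | succ n ih =>
      rw [pow_succ w, ih]
      push_cast
      linear_combination (n * y * y) * hpp - (1 + p * (n * y)) * hy
  have h1 : ((p - 1 : ℕ) : ZMod p) = -1 := by
    rw [Nat.cast_sub (Fact.out : p.Prime).one_le]; simp
  rw [hpow, eq_comm, ← sub_eq_iff_eq_add', ← hy, natCast_mul_eq_iff, map_mul, map_natCast]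
  simp [h1]

variable [TopologicalSpace G]

/-- A weakening of `LiftsCharacters σ`: only the open subgroups on which `σ ≡ 1` modulo `p`
are considered. -/
def LiftsUntwisted (σ : G →* ZMod (p ^ 2)) : Prop :=
  ∀ K : Subgroup G, IsOpen (K : Set G) → (∀ g ∈ K, redSq p (σ g) = 1) →
    ∀ f : K → ZMod p, IsLocallyConstant f →
    (∀ g h, f (g * h) = f g + f h) → ∃ f' : K → ZMod (p ^ 2), IsLocallyConstant f' ∧
      (∀ g h, f' (g * h) = f' g + σ g * f' h) ∧ ∀ g, redSq p (f' g) = f g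

/-- Corestriction from the open subgroup on which `σ ≡ 1` modulo `p`, whose index is prime to
`p`, reduces the lifting property for `σ ^ (p - 1) ^ 2` to that subgroup.  The exponent is
`1` modulo `p` and `0` modulo `p - 1`, so the power is trivial modulo `p` and
agrees with `σ` on the subgroup. -/
lemma LiftsUntwisted.liftsCharacters [IsTopologicalGroup G] [CompactSpace G]
    {σ : G →* ZMod (p ^ 2)} (hσ : IsLocallyConstant σ) (h : LiftsUntwisted σ) :
    LiftsCharacters (σ ^ (p - 1) ^ 2) := by
  classical
  intro K hK f hf hfm
  set τ := σ ^ (p - 1) ^ 2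
  let φ : G →* (ZMod p)ˣ := ((redSq p : ZMod (p ^ 2) →* ZMod p).comp σ).toHomUnits
  have hφ (g : G) : g ∈ φ.ker ↔ redSq p (σ g) = 1 := by
    rw [MonoidHom.mem_ker, Units.ext_iff]; rfl
  have hφo : IsOpen (φ.ker : Set G) := by
    have : (φ.ker : Set G) = (fun g => redSq p (σ g)) ⁻¹' {1} := by
      ext g
      exact hφ g
    rw [this]
    exact (hσ.comp (redSq p)).isOpen_fiber 1
  obtain ⟨f₀, hf₀, hf₀m, hf₀r⟩ := h (K ⊓ φ.ker) (hK.inter hφo) (fun g hg => (hφ g).1 hg.2)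
    (fun g => f ⟨g, g.2.1⟩) (hf.comp_continuous
      (f := fun g : (K ⊓ φ.ker : Subgroup G) => (⟨g, g.2.1⟩ : K)) (by fun_prop))
    fun g h => hfm ⟨g, g.2.1⟩ ⟨h, h.2.1⟩
  let N : Subgroup K := (φ.comp K.subtype).ker
  have hNmem (n : N) : ((n : K) : G) ∈ K ⊓ φ.ker := ⟨n.1.2, n.2⟩
  have hNo : IsOpen (N : Set K) := hφo.preimage continuous_subtype_val
  have : CompactSpace K :=
    isCompact_iff_compactSpace.1 (Subgroup.isClosed_of_isOpen K hK).isCompact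
  have : Finite (K ⧸ N) := N.quotient_finite_of_isOpen hNo
  let _ : Fintype (K ⧸ N) := Fintype.ofFinite _
  let ρ : Representation ℤ K (ZMod (p ^ 2)) := mulRep (τ.comp K.subtype)
  let c : Z1 (resRep ρ N) := ⟨fun n => f₀ ⟨n, hNmem n⟩,
    hf₀.comp_continuous (f := fun n : N => (⟨n, hNmem n⟩ : (K ⊓ φ.ker : Subgroup G)))
      (by fun_prop), fun g h => by
      have h1 := hf₀m ⟨g, hNmem g⟩ ⟨h, hNmem h⟩
      have h2 : τ ((g : K) : G) = σ ((g : K) : G) :=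
        pow_sub_one_sq_of_redSq_eq_one ((hφ _).1 g.2)
      change _ = _ + τ ((g : K) : G) * _
      rw [h2]
      exact h1⟩
  have hcor (g : K) : redSq p ((Z1.cor ρ N hNo c).1 g) = N.index * f g := by
    rw [cor_apply, map_sum, ← nsmul_eq_mul, ← sum_transversalElt_res hfm N g]
    refine Finset.sum_congr rfl fun x _ => ?_
    change redSq p (τ _ * _) = _
    rw [map_mul, redSq_pow_sub_one_sq, one_mul]
    exact hf₀r _
  have hindex : (N.index : ZMod p) ≠ 0 := by
    rw [Ne, ZMod.natCast_eq_zero_iff]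
    intro hdvd
    have h1 : N.index ∣ p - 1 := by
      rw [Subgroup.index_ker, ← ZMod.card_units p, ← Nat.card_eq_fintype_card]
      exact Subgroup.card_subgroup_dvd_card _
    have hp := (Fact.out : p.Prime)
    have := Nat.le_of_dvd (Nat.sub_pos_of_lt hp.one_lt) (hdvd.trans h1)
    have := hp.pos
    omega
  have hcm (g h : K) : (Z1.cor ρ N hNo c).1 (g * h) =
      (Z1.cor ρ N hNo c).1 g + τ g * (Z1.cor ρ N hNo c).1 h := (Z1.cor ρ N hNo c).2.2 g h
  refine ⟨fun g => liftSq p (N.index : ZMod p)⁻¹ * (Z1.cor ρ N hNo c).1 g,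
    (Z1.cor ρ N hNo c).2.1.comp _, fun g h => ?_, fun g => ?_⟩
  · beta_reduce
    rw [hcm]
    ring
  · rw [map_mul, hcor, redSq_liftSq, inv_mul_cancel_left₀ hindex]

end Untwist

/-! ### Lifting from formal Hilbert 90 and from Hilbert 90 modules -/

section Hilbert90

variable {p : ℕ} [Fact p.Prime]

lemma isLocallyConstant_toZModPow (n : ℕ) :
    IsLocallyConstant (PadicInt.toZModPow n : ℤ_[p] →+* ZMod (p ^ n)) := by
  rw [IsLocallyConstant.iff_eventually_eq]
  intro x
  have hpos : (0 : ℝ) < (p : ℝ) ^ (-(n : ℤ)) :=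
    zpow_pos (Nat.cast_pos.2 (Fact.out : p.Prime).pos) _
  filter_upwards [Metric.closedBall_mem_nhds x hpos] with y hy
  rw [Metric.mem_closedBall, dist_eq_norm, PadicInt.norm_le_pow_iff_mem_span_pow,
    ← PadicInt.ker_toZModPow, RingHom.mem_ker, map_sub, sub_eq_zero] at hy
  exact hy

lemma toZModPow_two_eq_zero_iff (a : ℤ_[p]) :
    PadicInt.toZModPow 2 a = 0 ↔ a ∈ Ideal.span {(p : ℤ_[p]) ^ 2} := by
  rw [← PadicInt.ker_toZModPow, RingHom.mem_ker]

lemma redSq_toZModPow_eq_zero_iff (a : ℤ_[p]) :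
    redSq p (PadicInt.toZModPow 2 a) = 0 ↔ a ∈ Ideal.span {(p : ℤ_[p]) ^ 1} := by
  have hp : (p : ℤ_[p]) ≠ 0 := Nat.cast_ne_zero.2 (Fact.out : p.Prime).ne_zero
  rw [← natCast_mul_eq_zero_iff, ← map_natCast (PadicInt.toZModPow 2) p, ← map_mul,
    toZModPow_two_eq_zero_iff, Ideal.mem_span_singleton, Ideal.mem_span_singleton, pow_two,
    mul_dvd_mul_iff_left hp, pow_one]

/-- The quotient of `ℤ_p` by `pⁿ` is identified with `ℤ/m` by any homomorphism `ℤ_p → ℤ/m` with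
kernel `pⁿ ℤ_p`. -/
noncomputable def zmod1Equiv {m n : ℕ} (φ : ℤ_[p] →+* ZMod m)
    (h : ∀ a, φ a = 0 ↔ a ∈ Ideal.span {(p : ℤ_[p]) ^ n}) : ZMod1 p n ≃+* ZMod m :=
  (Ideal.quotEquivOfEq (by ext a; rw [RingHom.mem_ker, h])).trans
    (RingHom.quotientKerEquivOfSurjective (ZMod.ringHom_surjective φ))

lemma zmod1Equiv_mk {m n : ℕ} (φ : ℤ_[p] →+* ZMod m)
    (h : ∀ a, φ a = 0 ↔ a ∈ Ideal.span {(p : ℤ_[p]) ^ n}) (a : ℤ_[p]) :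
    zmod1Equiv φ h (Submodule.Quotient.mk a) = φ a := rfl

lemma zmod1Equiv_smul {m n : ℕ} (φ : ℤ_[p] →+* ZMod m)
    (h : ∀ a, φ a = 0 ↔ a ∈ Ideal.span {(p : ℤ_[p]) ^ n}) (a : ℤ_[p]) (x : ZMod1 p n) :
    zmod1Equiv φ h (a • x) = φ a * zmod1Equiv φ h x := by
  obtain ⟨b, rfl⟩ := Submodule.Quotient.mk_surjective _ x
  rw [← Submodule.Quotient.mk_smul, zmod1Equiv_mk, zmod1Equiv_mk, smul_eq_mul, map_mul]

variable {G : Type u} [Group G] [TopologicalSpace G]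

/-- The reduction modulo `p²` of a character with values in `ℤ_pˣ`. -/
noncomputable def charSq (θ : G →ₜ* ℤ_[p]ˣ) : G →* ZMod (p ^ 2) :=
  ((PadicInt.toZModPow 2 : ℤ_[p] →+* ZMod (p ^ 2)) : ℤ_[p] →* ZMod (p ^ 2)).comp
    ((Units.coeHom ℤ_[p]).comp (θ : G →* ℤ_[p]ˣ))

lemma isLocallyConstant_charSq (θ : G →ₜ* ℤ_[p]ˣ) : IsLocallyConstant (charSq θ) :=
  (isLocallyConstant_toZModPow 2).comp_continuous
    (Units.continuous_val.comp θ.continuous_toFun)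

lemma FormalHilbert90.liftsUntwisted {θ : G →ₜ* ℤ_[p]ˣ} (h : FormalHilbert90 θ) :
    LiftsUntwisted (charSq θ) := by
  intro K hK hK1 f hf hfm
  let E₁ : ZMod1 p 1 ≃+* ZMod p :=
    zmod1Equiv ((redSq p).comp (PadicInt.toZModPow 2)) redSq_toZModPow_eq_zero_iff
  let E₂ : ZMod1 p 2 ≃+* ZMod (p ^ 2) :=
    zmod1Equiv (PadicInt.toZModPow 2) toZModPow_two_eq_zero_iff
  -- the action on `ℤ/p(1)` is trivial, so that `f` is a cocycle and coboundaries vanish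
  have hsmul (g : K) (x : ZMod1 p 1) : ((θ g : ℤ_[p]ˣ) : ℤ_[p]) • x = x := by
    apply E₁.injective
    refine (zmod1Equiv_smul _ redSq_toZModPow_eq_zero_iff _ _).trans ?_
    change redSq p (charSq θ g) * _ = _
    rw [hK1 g g.2, one_mul]
  obtain ⟨ξ, hξ⟩ := h K hK 2 one_le_two (H1.mk _ ⟨fun g => E₁.symm (f g), hf.comp _,
    fun g h => by
      change E₁.symm (f (g * h)) = E₁.symm (f g) + ((θ g : ℤ_[p]ˣ) : ℤ_[p]) • E₁.symm (f h)
      rw [hsmul, hfm, map_add]⟩)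
  obtain ⟨c, rfl⟩ := H1.mk_surjective _ ξ
  obtain ⟨a, ha⟩ := (QuotientAddGroup.eq).1 hξ
  refine ⟨fun g => E₂ (c.1 g), c.2.1.comp _, fun g h => ?_, fun g => ?_⟩
  · have : c.1 (g * h) = c.1 g + ((θ g : ℤ_[p]ˣ) : ℤ_[p]) • c.1 h := c.2.2 g h
    beta_reduce
    rw [this, map_add]
    exact congrArg _ (zmod1Equiv_smul _ toZModPow_two_eq_zero_iff _ _)
  · have h1 : ((θ g : ℤ_[p]ˣ) : ℤ_[p]) • a - a =
        -(reduction ((θ : G →* ℤ_[p]ˣ).comp K.subtype) 2 one_le_two) (c.1 g) + E₁.symm (f g) :=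
      congrFun ha g
    rw [hsmul, sub_self, eq_comm, neg_add_eq_zero] at h1
    rw [← E₁.apply_symm_apply (f g), ← h1]
    obtain ⟨b, hb⟩ := Submodule.Quotient.mk_surjective _ (c.1 g)
    beta_reduce
    rw [← hb]
    rfl

/-- The `p²`-torsion of a Hilbert 90 module is `ℤ/p²(1)`. -/
lemma IsHilbert90Module.exists_torsion_embedding {θ : G →ₜ* ℤ_[p]ˣ} {M : Type v}
    [AddCommGroup M] {ρ : Representation ℤ G M} (h : IsHilbert90Module θ ρ) :
    ∃ J : ZMod (p ^ 2) →+ M, Function.Injective J ∧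
      (∀ g r, ρ g (J r) = J (charSq θ g * r)) ∧ ∀ m, p ^ 2 • m = 0 → ∃ r, J r = m := by
  obtain ⟨e, he⟩ := h.torsion
  have hp : (p : ℚ_[p]) ^ 2 ≠ 0 :=
    pow_ne_zero 2 (Nat.cast_ne_zero.2 (Fact.out : p.Prime).ne_zero)
  let mk : ℚ_[p] →ₗ[ℤ_[p]] QpModZp p := Submodule.mkQ _
  let j : ℤ_[p] →+ M := AddMonoidHom.mk'
    (fun a => ((e.symm (mk ((a : ℚ_[p]) / p ^ 2)) : AddCommGroup.primaryComponent M p) : M))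
    fun a b => by rw [PadicInt.coe_add, add_div, map_add, map_add, AddSubgroup.coe_add]
  have hj0 (a : ℤ_[p]) : j a = 0 ↔ PadicInt.toZModPow 2 a = 0 := by
    change ((e.symm (mk _) : AddCommGroup.primaryComponent M p) : M) = 0 ↔ _
    rw [ZeroMemClass.coe_eq_zero, EmbeddingLike.map_eq_zero_iff, toZModPow_two_eq_zero_iff,
      Ideal.mem_span_singleton, Submodule.mkQ_apply, Submodule.Quotient.mk_eq_zero]
    constructor
    · rintro ⟨b, hb⟩
      refine ⟨b, PadicInt.ext ?_⟩
      change (b : ℚ_[p]) = _ at hb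
      rw [eq_div_iff hp] at hb
      rw [← hb]
      push_cast
      ring
    · rintro ⟨b, rfl⟩
      refine ⟨b, ?_⟩
      change (b : ℚ_[p]) = _
      rw [eq_div_iff hp]
      push_cast
      ring
  have hj (a b : ℤ_[p]) : j a = j b ↔ PadicInt.toZModPow 2 a = PadicInt.toZModPow 2 b := by
    rw [← sub_eq_zero, ← map_sub, hj0, map_sub, sub_eq_zero]
  have hjg (g : G) (a : ℤ_[p]) : ρ g (j a) = j ((θ g : ℤ_[p]ˣ) * a) := by
    have h1 := he g (e.symm (mk ((a : ℚ_[p]) / p ^ 2)))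
    rw [AddEquiv.apply_symm_apply, ← AddEquiv.eq_symm_apply, Subtype.ext_iff] at h1
    refine h1.trans ?_
    change ((e.symm (((θ g : ℤ_[p]ˣ) : ℤ_[p]) • mk _) : AddCommGroup.primaryComponent M p) : M) =
      ((e.symm (mk _) : AddCommGroup.primaryComponent M p) : M)
    rw [← map_smul, PadicInt.coe_mul, mul_div_assoc]
    rfl
  have hjs (m : M) (hm : p ^ 2 • m = 0) : ∃ a, j a = m := by
    have hmp : m ∈ AddCommGroup.primaryComponent M p := ⟨2, hm⟩
    obtain ⟨q, hq⟩ := Submodule.mkQ_surjective _ (e ⟨m, hmp⟩)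
    have h1 : mk (p ^ 2 • q) = 0 := by
      change p ^ 2 • mk q = 0
      have : mk q = e ⟨m, hmp⟩ := hq
      rw [this, ← map_nsmul, EmbeddingLike.map_eq_zero_iff]
      exact Subtype.ext hm
    obtain ⟨a, ha⟩ := (Submodule.Quotient.mk_eq_zero _).1 h1
    refine ⟨a, ?_⟩
    change (a : ℚ_[p]) = _ at ha
    change ((e.symm (mk _) : AddCommGroup.primaryComponent M p) : M) = m
    rw [ha, nsmul_eq_mul, Nat.cast_pow, mul_div_cancel_left₀ _ hp]
    change ((e.symm (Submodule.mkQ _ q) : AddCommGroup.primaryComponent M p) : M) = m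
    rw [hq, AddEquiv.symm_apply_apply]
  let l : ZMod (p ^ 2) → ℤ_[p] := Function.surjInv (ZMod.ringHom_surjective (PadicInt.toZModPow 2))
  have hl (r : ZMod (p ^ 2)) : PadicInt.toZModPow 2 (l r) = r := Function.surjInv_eq _ r
  refine ⟨AddMonoidHom.mk' (fun r => j (l r)) fun r s => ?_, fun r s hrs => ?_, fun g r => ?_,
    fun m hm => ?_⟩
  · rw [← map_add, hj, map_add, hl, hl, hl]
  · have := (hj _ _).1 hrs
    rwa [hl, hl] at this
  · change ρ g (j _) = j _
    rw [hjg, hj, map_mul, hl, hl]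
    rfl
  · obtain ⟨a, rfl⟩ := hjs m hm
    exact ⟨PadicInt.toZModPow 2 a, (hj _ _).2 (hl _)⟩

variable [IsTopologicalGroup G]

lemma IsDiscreteModule.isLocallyConstant_d0 {M : Type v} [AddCommGroup M]
    {ρ : Representation ℤ G M} (h : IsDiscreteModule ρ) (m : M) :
    IsLocallyConstant (d0 ρ m) := by
  rw [IsLocallyConstant.iff_eventually_eq]
  intro g
  have hc : Continuous fun k : G => g⁻¹ * k := by fun_prop
  have hmem : g ∈ (fun k : G => g⁻¹ * k) ⁻¹' {k | ρ k m = m} := by simp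
  filter_upwards [((h m).preimage hc).mem_nhds hmem] with k hk
  have hk' : ρ (g⁻¹ * k) m = m := hk
  have : ρ k m = ρ g m := by
    conv_rhs => rw [← hk', ← Module.End.mul_apply, ← map_mul, mul_inv_cancel_left]
  change ρ k m - m = ρ g m - m
  rw [this]

/-- A Hilbert 90 module allows to lift characters by Kummer theory: if `f` is the coboundary of
`m` and `p m' = m`, then the coboundary of `m'` is a lift of `f`. -/
lemma IsHilbert90Module.liftsUntwisted {θ : G →ₜ* ℤ_[p]ˣ} {M : Type v} [AddCommGroup M]
    {ρ : Representation ℤ G M} (h : IsHilbert90Module θ ρ) : LiftsUntwisted (charSq θ) := by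
  intro K hK hK1 f hf hfm
  obtain ⟨J, hJ, hJg, hJs⟩ := h.exists_torsion_embedding
  have := h.h1_eq_zero K hK
  have hF : (fun g => J (p * liftSq p (f g))) ∈ Z1 (resRep ρ K) := by
    refine ⟨hf.comp fun r => J (p * liftSq p r), fun g k => ?_⟩
    change J (p * liftSq p (f (g * k))) = J (p * liftSq p (f g)) + ρ g (J (p * liftSq p (f k)))
    rw [hJg, ← map_add, mul_left_comm, ← mul_add]
    congr 1
    rw [natCast_mul_eq_iff, map_add, map_mul, hK1 g g.2, hfm]
    simp only [redSq_liftSq, one_mul]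
  obtain ⟨m, hm⟩ : (⟨_, hF⟩ : Z1 (resRep ρ K)) ∈ (B1 (resRep ρ K)).addSubgroupOf _ :=
    (QuotientAddGroup.eq_zero_iff _).1 (Subsingleton.elim _ _)
  have hm' (g : K) : ρ g m - m = J (p * liftSq p (f g)) := congrFun hm g
  obtain ⟨m', rfl⟩ := h.divisible m
  have hpc (g : K) : p • (ρ g m' - m') = J (p * liftSq p (f g)) := by
    rw [← hm', smul_sub, map_nsmul]
  have hex (g : K) : ∃ r, J r = ρ g m' - m' := by
    apply hJs
    rw [pow_two, mul_smul, hpc, ← map_nsmul, nsmul_eq_mul, ← mul_assoc, ← Nat.cast_mul, ← pow_two,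
      ZMod.natCast_self, zero_mul, map_zero]
  choose f' hf' using hex
  refine ⟨f', ?_, fun g k => hJ ?_, fun g => ?_⟩
  · refine IsLocallyConstant.desc f' J ?_ hJ
    have e : J ∘ f' = d0 ρ m' ∘ ((↑) : K → G) := funext hf'
    rw [e]
    exact (h.discrete.isLocallyConstant_d0 m').comp_continuous continuous_subtype_val
  · rw [map_add, ← hJg, hf', hf', hf', Subgroup.coe_mul, map_mul, map_sub, Module.End.mul_apply]
    abel
  · rw [← redSq_liftSq (f g), ← natCast_mul_eq_iff]
    apply hJ
    rw [← hpc, ← hf', ← nsmul_eq_mul, map_nsmul]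

end Hilbert90
end ProfCoh

theorem proposition3p2 {p : ℕ} [Fact p.Prime]
    {G : Type u} [Group G] [TopologicalSpace G] [IsTopologicalGroup G]
    [CompactSpace G] [TotallyDisconnectedSpace G]
    (θ : G →ₜ* ℤ_[p]ˣ)
    (hθ : ProfCoh.AdmitsHilbert90Module.{u, v} θ ∨ ProfCoh.FormalHilbert90 θ)
    (χ : G →ₜ* Multiplicative (ZMod p)) :
    Function.Exact (ProfCoh.corKer χ) (ProfCoh.cupChar χ) ∧
      Function.Exact (ProfCoh.cupChar χ) (ProfCoh.resKer χ) := by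
  have hl : ProfCoh.LiftsUntwisted (ProfCoh.charSq θ) := by
    rcases hθ with ⟨M, _, ρ, h⟩ | h
    · exact h.liftsUntwisted
    · exact h.liftsUntwisted
  have hc := ProfCoh.isLocallyConstant_charSq θ
  have hτ : IsLocallyConstant (ProfCoh.charSq θ ^ (p - 1) ^ 2 : G →* ZMod (p ^ 2)) :=
    (funext fun _ => MonoidHom.pow_apply .. : ⇑(ProfCoh.charSq θ ^ (p - 1) ^ 2) =
      (· ^ (p - 1) ^ 2) ∘ ProfCoh.charSq θ) ▸ hc.comp _
  have hτ1 := ProfCoh.redSq_pow_sub_one_sq (ProfCoh.charSq θ)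
  have hl' := hl.liftsCharacters hc
  exact ⟨ProfCoh.exact_corKer_cupChar χ hτ hτ1 hl', ProfCoh.exact_cupChar_resKer χ hτ hτ1 hl'⟩
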